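/- **Setting.** Let $\Theta\subset\mathbb R^d$ be nonempty, compact and convex. For $\theta$ in an open neighbourhood $U$ of $\Theta$ let $f_X(\cdot;\theta)$ be a probability density (w.r.t. Lebesgue measure) that is positive on a set $\mathcal X\subset\mathbb R^m$ and carried by it, and differentiable in $\theta$ at each $\theta\in\Theta$. Let $\mathcal L:\mathbb R^m\to\mathbb R$ be measurable, and let $Y(\theta)=\mathcal L(X(\theta))$ with $X(\theta)\sim f_X(\cdot;\theta)$; denote by $F(\cdot;\theta)$, $f(\cdot;\theta)$ and $F^{-1}(z;\theta)=\inf\{y:F(y;\theta)\ge z\}$ its distribution function, density and quantile function. Let $w:[0,1]\to[0,1]$ be of class $C^1[0,1]$ with $w(0)=0$, $w(1)=1$, put $\tilde w(z)=w(1-z)$, and fix a grid $0<z_0<z_1<\dots<z_N<1$. Define, for $\theta\in\Theta$, $$\nabla J^q_N(\theta)=\sum_{i=1}^N \nabla_\theta F(q;\theta)\big|_{q=F^{-1}(z_i;\theta)}\,\tilde w'(z_i)\,\bigl(F^{-1}(z_i;\theta)-F^{-1}(z_{i-1};\theta)\bigr).$$ **Recursions.** Let $G_1(x;\theta,y)=-\mathbf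 1\{\mathcal L(x)\le y\}\,\nabla_\theta\ln f_X(x;\theta)$, and let $\varphi_\Theta$ be the Euclidean projection onto $\Theta$. Starting from random $\theta_0\in\Theta$ and $q_{0,0},\dots,q_{0,N}\in\mathbb R$, let, for $k\ge 0$, $$q_{k+1,i}=q_{k,i}+\gamma^q_k\bigl(z_i-\mathbf 1\{Y_k\le q_{k,i}\}\bigr),\qquad i=0,\dots,N,$$ $$\theta_{k+1}=\varphi_\Theta\Bigl(\theta_k+\gamma^\theta_k\sum_{i=1}^N\bigl(-G_1(X_k;\theta_k,q_{k,i})\bigr)\,\tilde w'(z_i)\,(q_{k,i}-q_{k,i-1})\Bigr),$$ where $Y_k=\mathcal L(X_k)$ and, conditionally on $\sigma(\theta_0,q_0,\dots,\theta_k,q_k)$, $X_k$ has density $f_X(\cdot;\theta_k)$. **Assumptions.** (1) $Y(\theta)$ has a density; $f(y;\theta)$ and $\nabla_\theta F(y;\theta)$ exist and are continuous in $(y,\theta)\in\mathbb R\times\Theta$; $F^{-1}(z;\theta)$ and $\nabla_\theta F^{-1}(z;\theta)$ exist and are continuous in $(z,\theta)\in(0,1)\times\Theta$. (2) $\gamma^q_k,\gamma^\theta_k>0$,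 $\sum_k\gamma^q_k=\sum_k\gamma^\theta_k=\infty$, $\sum_k(\gamma^q_k)^2<\infty$, $\sum_k(\gamma^\theta_k)^2<\infty$, and $\gamma^\theta_k=o(\gamma^q_k)$. (3) $\nabla_\theta\ln f_X(x;\theta)$ is bounded on $\mathcal X\times\Theta$. (4) Almost surely there are $\varepsilon\in(0,1)$ and $C>0$ (possibly depending on the sample path) such that for all $k$: $f(y;\theta_k)>\varepsilon$ for every $y$ lying between $q_{j,i}$ and $F^{-1}(z_i;\theta_j)$ for some $j\ge0$ and $1\le i\le N$, and $f(y;\theta_k)<C$ for all $y\in\mathbb R$. **Conclusion.** Almost surely $\theta_k$ converges to a limit set of the projected ODE $$\dot\theta(t)=\nabla J^q_N(\theta(t))+p(t),\qquad -p(t)\in C(\theta(t)),$$ where $C(\theta)$ is the normal cone to $\Theta$ at $\theta$ (solutions are locally absolutely continuous functions $[0,\infty)\to\Theta$ that satisfy this for almost every $t$). That is, almost surely there is a set $L$ such that $L$ is the set of all limit points of $(\theta_k)$, $\mathrm{dist}(\theta_k,L)\to0$, and * $L$ is a limit set of the projected ODE: for some nonempty family $S$ of solutions, $L=\bigcap_{T\ge0}\overline{\{x(t):x\in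 S,\ t\ge T\}}$; * $L$ is internally chain transitive: for all $a,b\in L$, $\varepsilon>0$ and $T>0$ there are finitely many solutions $x_0,\dots,x_n$ and times $t_0,\dots,t_n\ge T$ with $x_j([0,t_j])\subset L$ for all $j$, $|a-x_0(0)|\le\varepsilon$, $|x_j(t_j)-x_{j+1}(0)|\le\varepsilon$ for $j<n$, and $|x_n(t_n)-b|\le\varepsilon$. -/

import Mathlib

open MeasureTheory Filter Topology Set Asymptotics
open scoped RealInnerProductSpace

namespace DRM

/-- The stochastic model.  The decision variable ranges over the compact convex set `Θ ⊆ ℝ^d`;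
the input `X(θ)` takes values in `𝒳 ⊆ ℝ^m` with density `fX · θ`, and the observable is
`Y = 𝓛 (X(θ))`.  The input densities are given on an open neighbourhood `U` of `Θ`, so that
gradients in `θ` make sense at every point of `Θ`. -/
structure Model (d m : ℕ) where
  Θ : Set (EuclideanSpace ℝ (Fin d))
  U : Set (EuclideanSpace ℝ (Fin d))
  𝒳 : Set (EuclideanSpace ℝ (Fin m))
  fX : EuclideanSpace ℝ (Fin m) → EuclideanSpace ℝ (Fin d) → ℝ
  𝓛 : EuclideanSpace ℝ (Fin m) → ℝ
  isCompact_Θ : IsCompact Θ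
  convex_Θ : Convex ℝ Θ
  nonempty_Θ : Θ.Nonempty
  isOpen_U : IsOpen U
  subset_U : Θ ⊆ U
  measurableSet_𝒳 : MeasurableSet 𝒳
  measurable_𝓛 : Measurable 𝓛
  measurable_fX : Measurable (Function.uncurry fX)
  fX_pos : ∀ x ∈ 𝒳, ∀ θ ∈ U, 0 < fX x θ
  fX_integral : ∀ θ ∈ U, ∫ x in 𝒳, fX x θ = 1
  fX_differentiable : ∀ x ∈ 𝒳, ∀ θ ∈ Θ, DifferentiableAt ℝ (fX x) θ

namespace Model

variable {d m : ℕ} (M : Model d m)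

/-- The CDF `F(y; θ)` of the observable. -/
noncomputable def cdf (y : ℝ) (θ : EuclideanSpace ℝ (Fin d)) : ℝ :=
  ∫ x in M.𝒳 ∩ {x | M.𝓛 x ≤ y}, M.fX x θ

/-- The density `f(y; θ)` of the observable, as the derivative of the CDF. -/
noncomputable def pdf (y : ℝ) (θ : EuclideanSpace ℝ (Fin d)) : ℝ :=
  deriv (fun y' => M.cdf y' θ) y

/-- The quantile function `F⁻¹(z; θ) = inf {y | z ≤ F(y; θ)}`. -/
noncomputable def quantile (z : ℝ) (θ : EuclideanSpace ℝ (Fin d)) : ℝ :=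
  sInf {y | z ≤ M.cdf y θ}

/-- The gradient `∇_θ F(y; θ)`. -/
noncomputable def gradCdf (y : ℝ) (θ : EuclideanSpace ℝ (Fin d)) : EuclideanSpace ℝ (Fin d) :=
  gradient (fun ϑ => M.cdf y ϑ) θ

/-- The gradient `∇_θ F⁻¹(z; θ)`. -/
noncomputable def gradQuantile (z : ℝ) (θ : EuclideanSpace ℝ (Fin d)) :
    EuclideanSpace ℝ (Fin d) :=
  gradient (fun ϑ => M.quantile z ϑ) θ

/-- The score function `∇_θ ln f_X(x; θ)`. -/
noncomputable def score (x : EuclideanSpace ℝ (Fin m)) (θ : EuclideanSpace ℝ (Fin d)) :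
    EuclideanSpace ℝ (Fin d) :=
  gradient (fun ϑ => Real.log (M.fX x ϑ)) θ

open Classical in
/-- The estimator `G₁(x; θ, y) = -1{𝓛(x) ≤ y} ∇_θ ln f_X(x; θ)` of `-∇_θ F(y; θ)`. -/
noncomputable def G₁ (x : EuclideanSpace ℝ (Fin m)) (θ : EuclideanSpace ℝ (Fin d)) (y : ℝ) :
    EuclideanSpace ℝ (Fin d) :=
  -((if M.𝓛 x ≤ y then (1 : ℝ) else 0) • M.score x θ)

/-- Smoothness of the distribution of the observable: it has a density, jointly continuous on
`ℝ × Θ`; `∇_θ F` exists and is jointly continuous on `ℝ × Θ`; `F⁻¹` and `∇_θ F⁻¹` exist and are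
jointly continuous in `θ ∈ Θ` and in the level `z`, where `0 < z < 1`. -/
structure SmoothQuantiles : Prop where
  cdf_differentiable : ∀ θ ∈ M.Θ, Differentiable ℝ (fun y => M.cdf y θ)
  pdf_continuous : ContinuousOn (fun p : ℝ × EuclideanSpace ℝ (Fin d) => M.pdf p.1 p.2)
    (univ ×ˢ M.Θ)
  cdf_differentiable_param : ∀ y : ℝ, ∀ θ ∈ M.Θ, DifferentiableAt ℝ (fun ϑ => M.cdf y ϑ) θ
  gradCdf_continuous : ContinuousOn
    (fun p : ℝ × EuclideanSpace ℝ (Fin d) => M.gradCdf p.1 p.2) (univ ×ˢ M.Θ)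
  quantile_continuous : ContinuousOn
    (fun p : ℝ × EuclideanSpace ℝ (Fin d) => M.quantile p.1 p.2) (Ioo 0 1 ×ˢ M.Θ)
  quantile_differentiable : ∀ z ∈ Ioo (0 : ℝ) 1, ∀ θ ∈ M.Θ,
    DifferentiableAt ℝ (fun ϑ => M.quantile z ϑ) θ
  gradQuantile_continuous : ContinuousOn
    (fun p : ℝ × EuclideanSpace ℝ (Fin d) => M.gradQuantile p.1 p.2) (Ioo 0 1 ×ˢ M.Θ)

/-- The score function is bounded on `𝒳 × Θ`. -/
def BoundedScore : Prop :=
  ∃ C : ℝ, 0 < C ∧ ∀ x ∈ M.𝒳, ∀ θ ∈ M.Θ, ‖M.score x θ‖ ≤ C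

/-- The vector field `∇_θ J^q_N(θ)` for the distortion function `w` and the grid `z`:
`∑_{i=1}^N ∇_θ F(q; θ)|_{q = F⁻¹(zᵢ; θ)} w̃'(zᵢ) (F⁻¹(zᵢ; θ) - F⁻¹(zᵢ₋₁; θ))`,
where `w̃(s) = w(1 - s)`. -/
noncomputable def gradJ {N : ℕ} (w : ℝ → ℝ) (z : Fin (N + 1) → ℝ)
    (θ : EuclideanSpace ℝ (Fin d)) : EuclideanSpace ℝ (Fin d) :=
  ∑ i : Fin N, (deriv (fun s => w (1 - s)) (z i.succ) *
    (M.quantile (z i.succ) θ - M.quantile (z i.castSucc) θ)) •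
      M.gradCdf (M.quantile (z i.succ) θ) θ

end Model

/-- A distortion function of class `C¹[0,1]`. -/
structure IsC1Distortion (w : ℝ → ℝ) : Prop where
  mapsTo : MapsTo w (Icc 0 1) (Icc 0 1)
  map_zero : w 0 = 0
  map_one : w 1 = 1
  contDiffOn : ContDiffOn ℝ 1 w (Icc 0 1)

/-- A grid `0 < z₀ < z₁ < ⋯ < z_N < 1`. -/
structure IsGrid {N : ℕ} (z : Fin (N + 1) → ℝ) : Prop where
  strictMono : StrictMono z
  mem_Ioo : ∀ i, z i ∈ Ioo (0 : ℝ) 1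

/-- Positive step sizes with `∑ γ_k = ∞` and `∑ γ_k² < ∞`. -/
structure IsStepSize (γ : ℕ → ℝ) : Prop where
  pos : ∀ k, 0 < γ k
  sum_eq_top : Tendsto (fun n => ∑ k ∈ Finset.range n, γ k) atTop atTop
  sum_sq : Summable (fun k => γ k ^ 2)

/-- `y` is the Euclidean projection `φ_S(x)` of `x` onto `S`. -/
def IsProjection {d : ℕ} (S : Set (EuclideanSpace ℝ (Fin d)))
    (x y : EuclideanSpace ℝ (Fin d)) : Prop :=
  y ∈ S ∧ ∀ v ∈ S, ‖x - y‖ ≤ ‖x - v‖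

/-- The history `σ(θ_0, q_0, …, θ_k, q_k)` of the iterates. -/
@[reducible] def history {d N : ℕ} {Ω : Type*} (θ : ℕ → Ω → EuclideanSpace ℝ (Fin d))
    (q : ℕ → Ω → Fin (N + 1) → ℝ) (k : ℕ) : MeasurableSpace Ω :=
  ⨆ j ∈ Finset.range (k + 1), MeasurableSpace.comap (fun ω => (θ j ω, q j ω)) inferInstance

open Classical in
/-- The two-timescale recursions in QF-form.  Given the history of the iterates, the input `X_k`
is drawn from the density `f_X(·; θ_k)`, and `Y_k = 𝓛(X_k)`. -/
structure IsQFRecursion {d m N : ℕ} (M : Model d m) (w : ℝ → ℝ) (z : Fin (N + 1) → ℝ)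
    (γq γθ : ℕ → ℝ) {Ω : Type*} [MeasurableSpace Ω] (μ : Measure Ω)
    (X : ℕ → Ω → EuclideanSpace ℝ (Fin m)) (q : ℕ → Ω → Fin (N + 1) → ℝ)
    (θ : ℕ → Ω → EuclideanSpace ℝ (Fin d)) : Prop where
  measurable_X : ∀ k, Measurable (X k)
  measurable_q : ∀ k, Measurable (q k)
  measurable_θ : ∀ k, Measurable (θ k)
  init_mem : ∀ ω, θ 0 ω ∈ M.Θ
  sample : ∀ k, ∀ A : Set (EuclideanSpace ℝ (Fin m)), MeasurableSet A →
    μ[(X k ⁻¹' A).indicator (fun _ => (1 : ℝ)) | history θ q k]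
      =ᵐ[μ] fun ω => ∫ x in M.𝒳 ∩ A, M.fX x (θ k ω)
  step_q : ∀ k ω i, q (k + 1) ω i
    = q k ω i + γq k * (z i - if M.𝓛 (X k ω) ≤ q k ω i then 1 else 0)
  step_θ : ∀ k ω, IsProjection M.Θ
    (θ k ω + γθ k • ∑ i : Fin N, (deriv (fun s => w (1 - s)) (z i.succ) *
      (q k ω i.succ - q k ω i.castSucc)) • (-M.G₁ (X k ω) (θ k ω) (q k ω i.succ)))
    (θ (k + 1) ω)

/-- Almost surely, the densities `f(·; θ_k)` are bounded away from zero on the intervals between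
the estimates `q_{k,i}` and the quantiles `F⁻¹(zᵢ; θ_k)`, `i = 1, …, N`, and are bounded above on
`ℝ`, both uniformly in `k`. -/
def DensityBounds {d m N : ℕ} (M : Model d m) (z : Fin (N + 1) → ℝ)
    {Ω : Type*} [MeasurableSpace Ω] (μ : Measure Ω) (q : ℕ → Ω → Fin (N + 1) → ℝ)
    (θ : ℕ → Ω → EuclideanSpace ℝ (Fin d)) : Prop :=
  ∀ᵐ ω ∂μ, ∃ ε ∈ Ioo (0 : ℝ) 1, ∃ C : ℝ, 0 < C ∧
    (∀ k, ∀ y ∈ ⋃ (i : Fin N) (j : ℕ),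
        uIcc (q j ω i.succ) (M.quantile (z i.succ) (θ j ω)), ε < M.pdf y (θ k ω)) ∧
    (∀ k y, M.pdf y (θ k ω) < C)

/-- `x : [0, ∞) → Θ` solves the projected ODE `x' = h(x) + p` on the convex set `Θ`: `x` is
locally absolutely continuous with derivative `h(x) + p`, where for almost every `t` the correction
`-p(t)` lies in the normal cone to `Θ` at `x(t)`. -/
def IsProjectedSolution {d : ℕ} (Θ : Set (EuclideanSpace ℝ (Fin d)))
    (h : EuclideanSpace ℝ (Fin d) → EuclideanSpace ℝ (Fin d))
    (x : ℝ → EuclideanSpace ℝ (Fin d)) : Prop :=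
  ContinuousOn x (Ici 0) ∧ (∀ t, 0 ≤ t → x t ∈ Θ) ∧
  ∃ p : ℝ → EuclideanSpace ℝ (Fin d),
    (∀ t, 0 ≤ t → IntervalIntegrable p volume 0 t) ∧
    (∀ t, 0 ≤ t → IntervalIntegrable (fun s => h (x s)) volume 0 t) ∧
    (∀ t, 0 ≤ t → x t = x 0 + ∫ s in (0 : ℝ)..t, (h (x s) + p s)) ∧
    ∀ᵐ t : ℝ, 0 ≤ t → ∀ y ∈ Θ, ⟪-p t, y - x t⟫ ≤ 0

/-- The set of all limits of `x_n(t_n)` with `t_n → ∞` and `x_n` in the family `S` of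
trajectories. -/
def omegaLimitSet {d : ℕ} (S : Set (ℝ → EuclideanSpace ℝ (Fin d))) :
    Set (EuclideanSpace ℝ (Fin d)) :=
  ⋂ T : ℝ, closure {y | ∃ x ∈ S, ∃ t : ℝ, 0 ≤ t ∧ T ≤ t ∧ x t = y}

/-- `L` is a limit set of the projected ODE: the set of limit points, as time tends to infinity,
of a nonempty family of solutions. -/
def IsLimitSet {d : ℕ} (Θ : Set (EuclideanSpace ℝ (Fin d)))
    (h : EuclideanSpace ℝ (Fin d) → EuclideanSpace ℝ (Fin d))
    (L : Set (EuclideanSpace ℝ (Fin d))) : Prop :=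
  ∃ S : Set (ℝ → EuclideanSpace ℝ (Fin d)), S.Nonempty ∧
    (∀ x ∈ S, IsProjectedSolution Θ h x) ∧ L = omegaLimitSet S

/-- `L` is internally chain transitive for the projected ODE: any two points of `L` are joined,
up to arbitrarily small jumps, by finitely many arbitrarily long pieces of solutions in `L`. -/
def IsInternallyChainTransitive {d : ℕ} (Θ : Set (EuclideanSpace ℝ (Fin d)))
    (h : EuclideanSpace ℝ (Fin d) → EuclideanSpace ℝ (Fin d))
    (L : Set (EuclideanSpace ℝ (Fin d))) : Prop :=
  ∀ a ∈ L, ∀ b ∈ L, ∀ ε : ℝ, 0 < ε → ∀ T : ℝ, 0 < T →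
    ∃ (n : ℕ) (x : Fin (n + 1) → ℝ → EuclideanSpace ℝ (Fin d)) (t : Fin (n + 1) → ℝ),
      (∀ j, IsProjectedSolution Θ h (x j) ∧ T ≤ t j ∧ ∀ s ∈ Icc 0 (t j), x j s ∈ L) ∧
      dist a (x 0 0) ≤ ε ∧
      (∀ j : Fin n, dist (x j.castSucc (t j.castSucc)) (x j.succ 0) ≤ ε) ∧
      dist (x (Fin.last n) (t (Fin.last n))) b ≤ ε

end DRM

/-!
The argument is the ODE method for projected two-time-scale stochastic approximation, carried out with
a weak formulation in which neither the normal cone nor the interpolated noise has to be followed.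

**Weak formulation.** A Lipschitz curve `x` in the convex set `Θ` solves `x' = h(x) + p` with
`-p ∈ C(x)` if and only if, for each `y ∈ Θ`, the squared distance `‖x - y‖²` grows at a rate of at
most `2 ⟪h(x), x - y⟫`.  The discrete counterpart is immediate for a projected step, since the projection
onto `Θ` does not increase the distance to `y`, and it is stable under pointwise limits.  The sequences
with this property, up to vanishing errors and convergent noise, are the `IsApproxTrajectory`s.

**Limit paths.** Let `L` be the set of cluster points of such a sequence.  Seen from times
`s n → ∞`, its piecewise constant interpolation converges pointwise along an ultrafilter; the limits are
Lipschitz, stay in `L`, and solve the projected ODE (`isProjectedSolution_limitPath`).  Each point of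
`L` lies on such a path at any prescribed time, hence `L` is a limit set; and each late window of the
trajectory is shadowed by such a path, hence `L` is internally chain transitive: follow the trajectory
from a visit near `a` to a later visit near `b`.  Uniqueness of solutions plays no role.

**Fast time scale.** The quantile recursions have bounded martingale noise, which sums up
(`ae_tendsto_sum_sub_condExp`).  By the continuity of `F⁻¹` in its level, `F(·; θ)` is separated from `z`
away from `F⁻¹(z; θ)`, uniformly in `θ` (`exists_cdf_gap`).  A scalar recursion with such a drift is
bounded, and it tracks `F⁻¹(z; θ_k)` because `θ` moves on a slower time scale
(`tendsto_sub_quantile`).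

**Slow time scale.** The mean of the component of the search direction toward a point `v ∈ Θ` is
computed by differentiation under the integral sign along the segment from `θ_k` to `v`
(`setIntegral_fX_mul_scoreToward`); only such components enter the weak formulation.  Where the
projection is active, the search direction is not a function of the iterates, whereas the increment
of `‖θ_k - v‖²` is; centering this increment gives a martingale difference (`ae_variational`).
Restricting `v` to a countable dense subset of `Θ` leaves countably many null sets.
-/

namespace DRM

/-! ### The algorithmic clock -/

section Clock

/-- The algorithmic time `∑_{k < n} γ k` elapsed before step `n`. -/
noncomputable def clock (γ : ℕ → ℝ) (n : ℕ) : ℝ := ∑ k ∈ Finset.range n, γ k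

/-- The index of the step in progress at algorithmic time `u`: for `u ≥ 0` it is the `n` with
`clock γ n ≤ u < clock γ (n + 1)`. -/
noncomputable def stepAt (γ : ℕ → ℝ) (u : ℝ) : ℕ := sInf {n | u < clock γ (n + 1)}

variable {γ : ℕ → ℝ}

lemma clock_succ (n : ℕ) : clock γ (n + 1) = clock γ n + γ n := Finset.sum_range_succ _ _

lemma clock_strictMono (hpos : ∀ k, 0 < γ k) : StrictMono (clock γ) :=
  strictMono_nat_of_lt_succ fun n => by rw [clock_succ]; linarith [hpos n]

lemma clock_nonneg (hpos : ∀ k, 0 < γ k) (n : ℕ) : 0 ≤ clock γ n :=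
  Finset.sum_nonneg fun k _ => (hpos k).le

lemma sum_Ico_eq_clock {i j : ℕ} (hij : i ≤ j) :
    ∑ k ∈ Finset.Ico i j, γ k = clock γ j - clock γ i :=
  Finset.sum_Ico_eq_sub _ hij

lemma lt_clock_stepAt_succ (hsum : Tendsto (clock γ) atTop atTop) (u : ℝ) :
    u < clock γ (stepAt γ u + 1) :=
  Nat.sInf_mem (s := {n | u < clock γ (n + 1)})
    (((tendsto_add_atTop_iff_nat 1).2 hsum).eventually_gt_atTop u).exists

lemma clock_stepAt_le {u : ℝ} (hu : 0 ≤ u) : clock γ (stepAt γ u) ≤ u := by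
  rcases Nat.eq_zero_or_pos (stepAt γ u) with h | h
  · simpa [h, clock] using hu
  · have := Nat.notMem_of_lt_sInf (s := {n | u < clock γ (n + 1)}) (Nat.sub_lt h one_pos)
    simp only [mem_ofPred_eq, not_lt] at this
    rwa [show sInf {n | u < clock γ (n + 1)} = stepAt γ u from rfl,
      Nat.sub_add_cancel (n := stepAt γ u) (m := 1) h] at this

lemma le_stepAt (hpos : ∀ k, 0 < γ k) (hsum : Tendsto (clock γ) atTop atTop) {n : ℕ} {u : ℝ}
    (h : clock γ n ≤ u) : n ≤ stepAt γ u :=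
  Nat.lt_succ_iff.1 ((clock_strictMono hpos).lt_iff_lt.1
    (h.trans_lt (lt_clock_stepAt_succ hsum u)))

lemma stepAt_clock (hpos : ∀ k, 0 < γ k) (hsum : Tendsto (clock γ) atTop atTop) (n : ℕ) :
    stepAt γ (clock γ n) = n :=
  le_antisymm ((clock_strictMono hpos).le_iff_le.1 (clock_stepAt_le (clock_nonneg hpos n)))
    (le_stepAt hpos hsum le_rfl)

lemma tendsto_stepAt (hpos : ∀ k, 0 < γ k) (hsum : Tendsto (clock γ) atTop atTop) :
    Tendsto (stepAt γ) atTop atTop :=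
  tendsto_atTop.2 fun n => (eventually_ge_atTop (clock γ n)).mono fun _ h => le_stepAt hpos hsum h

lemma tendsto_clock_stepAt_sub (hpos : ∀ k, 0 < γ k) (hsum : Tendsto (clock γ) atTop atTop)
    (hγ : Tendsto γ atTop (𝓝 0)) : Tendsto (fun u => clock γ (stepAt γ u) - u) atTop (𝓝 0) := by
  have h := (hγ.comp (tendsto_stepAt hpos hsum)).neg
  rw [neg_zero] at h
  refine tendsto_of_tendsto_of_tendsto_of_le_of_le' h tendsto_const_nhds ?_ ?_
  · filter_upwards with u
    have := lt_clock_stepAt_succ hsum u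
    rw [clock_succ] at this
    simp only [Function.comp]
    linarith
  · filter_upwards [eventually_ge_atTop 0] with u hu
    linarith [clock_stepAt_le (γ := γ) hu]

end Clock

/-! ### Approximate trajectories and their limit paths -/

/-- A sequence in `Θ` that follows the projected ODE `x' = h(x) + p` with step sizes `γ`, in the
weak sense of an evolution variational inequality: up to an error `r k → 0` per unit of time and a
convergent series of noise terms `m k`, the squared distance to each point `y` of the test set `D`
grows at a rate of at most `2 ⟪h (θ k), θ k - y⟫`.  The normal cone does not appear: the projection
onto `Θ` only decreases the distance to `y`. -/
structure IsApproxTrajectory {d : ℕ} (Θ : Set (EuclideanSpace ℝ (Fin d)))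
    (h : EuclideanSpace ℝ (Fin d) → EuclideanSpace ℝ (Fin d)) (γ : ℕ → ℝ) (C : ℝ)
    (D : Set (EuclideanSpace ℝ (Fin d))) (θ : ℕ → EuclideanSpace ℝ (Fin d)) : Prop where
  step_pos : ∀ k, 0 < γ k
  clock_tendsto : Tendsto (clock γ) atTop atTop
  step_tendsto : Tendsto γ atTop (𝓝 0)
  isCompact : IsCompact Θ
  continuousOn : ContinuousOn h Θ
  dense_test : Θ ⊆ closure D
  nonneg : 0 ≤ C
  mem : ∀ k, θ k ∈ Θ
  increment_le : ∀ k, dist (θ k) (θ (k + 1)) ≤ C * γ k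
  variational : ∀ y ∈ D, ∃ r m : ℕ → ℝ, Tendsto r atTop (𝓝 0) ∧
    (∃ l, Tendsto (fun n => ∑ k ∈ Finset.range n, m k) atTop (𝓝 l)) ∧
    ∀ k, ‖θ (k + 1) - y‖ ^ 2 - ‖θ k - y‖ ^ 2 ≤ γ k * (2 * ⟪h (θ k), θ k - y⟫ + r k) + m k

/-- `x` is the pointwise limit, along the ultrafilter `V`, of the piecewise constant interpolation of
`θ` seen from the times `s n`. -/
def IsLimitPath {d : ℕ} (θ : ℕ → EuclideanSpace ℝ (Fin d)) (γ : ℕ → ℝ) (V : Ultrafilter ℕ)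
    (s : ℕ → ℝ) (x : ℝ → EuclideanSpace ℝ (Fin d)) : Prop :=
  ∀ t, Tendsto (fun n => θ (stepAt γ (s n + t))) V (𝓝 (x t))

/-- The set of cluster points of a sequence. -/
def clusterSet {d : ℕ} (θ : ℕ → EuclideanSpace ℝ (Fin d)) : Set (EuclideanSpace ℝ (Fin d)) :=
  {a | MapClusterPt a atTop θ}

/-- Fundamental theorem of calculus for Lipschitz curves in a Euclidean space. -/
lemma integral_deriv_of_lipschitz {d : ℕ} {K : NNReal} {x : ℝ → EuclideanSpace ℝ (Fin d)}
    (hx : LipschitzWith K x) (a b : ℝ) : ∫ s in a..b, deriv x s = x b - x a := by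
  have hint : IntervalIntegrable (deriv x) volume a b :=
    (intervalIntegrable_const (c := (K : ℝ))).mono_fun
      (stronglyMeasurable_deriv x).aestronglyMeasurable
      (Eventually.of_forall fun t => by simpa using norm_deriv_le_of_lipschitz hx)
  ext i
  have hcoord : LipschitzWith K fun t => x t i :=
    LipschitzWith.of_dist_le_mul fun s t =>
      (by simpa [dist_eq_norm] using PiLp.norm_apply_le (x s - x t) i :
        dist (x s i) (x t i) ≤ dist (x s) (x t)).trans (hx.dist_le_mul s t)
  have h1 := (hcoord.lipschitzOnWith (s := uIcc a b)).absolutelyContinuousOnInterval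
    |>.integral_deriv_eq_sub
  have h2 := (EuclideanSpace.proj i : EuclideanSpace ℝ (Fin d) →L[ℝ] ℝ).intervalIntegral_comp_comm
    hint
  rw [PiLp.sub_apply, ← h1]
  refine h2.symm.trans ?_
  refine intervalIntegral.integral_congr_ae ?_
  filter_upwards [hx.ae_differentiableAt_real] with t ht _
  exact (((EuclideanSpace.proj i : EuclideanSpace ℝ (Fin d) →L[ℝ] ℝ).hasFDerivAt.comp_hasDerivAt t
    ht.hasDerivAt).deriv).symm

section LimitPath

variable {d : ℕ} {Θ D : Set (EuclideanSpace ℝ (Fin d))}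
  {h : EuclideanSpace ℝ (Fin d) → EuclideanSpace ℝ (Fin d)} {γ : ℕ → ℝ} {C : ℝ}
  {θ : ℕ → EuclideanSpace ℝ (Fin d)} {V : Ultrafilter ℕ} {s : ℕ → ℝ}
  {x : ℝ → EuclideanSpace ℝ (Fin d)}

namespace IsApproxTrajectory

lemma exists_isLimitPath (H : IsApproxTrajectory Θ h γ C D θ) (V : Ultrafilter ℕ) (s : ℕ → ℝ) :
    ∃ x, IsLimitPath θ γ V s x := by
  have : ∀ t, ∃ a, Tendsto (fun n => θ (stepAt γ (s n + t))) V (𝓝 a) := fun t => by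
    obtain ⟨a, -, ha⟩ := H.isCompact.ultrafilter_le_nhds
      (V.map fun n => θ (stepAt γ (s n + t))) (le_principal_iff.2 (Ultrafilter.mem_map.2 <| univ_mem' fun n => H.mem _))
    exact ⟨a, ha⟩
  choose x hx using this
  exact ⟨x, hx⟩

lemma dist_le (H : IsApproxTrajectory Θ h γ C D θ) {i j : ℕ} (hij : i ≤ j) :
    dist (θ i) (θ j) ≤ C * (clock γ j - clock γ i) := by
  rw [← sum_Ico_eq_clock hij, Finset.mul_sum]
  exact dist_le_Ico_sum_of_dist_le hij fun _ _ => H.increment_le _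

lemma dist_le_abs (H : IsApproxTrajectory Θ h γ C D θ) (i j : ℕ) :
    dist (θ i) (θ j) ≤ C * |clock γ i - clock γ j| := by
  rcases le_total i j with hij | hij
  · exact (H.dist_le hij).trans (mul_le_mul_of_nonneg_left
      (by rw [abs_sub_comm]; exact le_abs_self _) H.nonneg)
  · rw [dist_comm]
    exact (H.dist_le hij).trans (mul_le_mul_of_nonneg_left (le_abs_self _) H.nonneg)

lemma tendsto_clock_sub (H : IsApproxTrajectory Θ h γ C D θ) (hs : Tendsto s V atTop) (t : ℝ) :
    Tendsto (fun n => clock γ (stepAt γ (s n + t)) - s n) V (𝓝 t) := by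
  have := ((tendsto_clock_stepAt_sub H.step_pos H.clock_tendsto H.step_tendsto).comp
    (tendsto_atTop_add_const_right _ t hs)).add_const t
  rw [zero_add] at this
  exact this.congr fun n => by simp only [Function.comp]; ring

lemma tendsto_stepAt_add (H : IsApproxTrajectory Θ h γ C D θ) (hs : Tendsto s V atTop) (t : ℝ) :
    Tendsto (fun n => stepAt γ (s n + t)) V atTop :=
  (tendsto_stepAt H.step_pos H.clock_tendsto).comp (tendsto_atTop_add_const_right _ t hs)

lemma limitPath_mem_clusterSet (H : IsApproxTrajectory Θ h γ C D θ) (hs : Tendsto s V atTop)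
    (hx : IsLimitPath θ γ V s x) (t : ℝ) : x t ∈ clusterSet θ :=
  ((hx t).mapClusterPt).of_comp (H.tendsto_stepAt_add hs t)

lemma clusterSet_subset (H : IsApproxTrajectory Θ h γ C D θ) : clusterSet θ ⊆ Θ := fun _ ha =>
  H.isCompact.isClosed.closure_eq ▸
    mem_closure_iff_clusterPt.2 (ClusterPt.mono ha
      (le_principal_iff.2 (mem_map.2 (univ_mem' H.mem))))

lemma dist_limitPath_le (H : IsApproxTrajectory Θ h γ C D θ) (hs : Tendsto s V atTop)
    (hx : IsLimitPath θ γ V s x) (t t' : ℝ) : dist (x t) (x t') ≤ C * |t - t'| := by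
  refine le_of_tendsto_of_tendsto ((hx t).dist (hx t'))
    (((H.tendsto_clock_sub hs t).sub (H.tendsto_clock_sub hs t')).abs.const_mul C)
    (Eventually.of_forall fun n => (H.dist_le_abs _ _).trans_eq ?_)
  simp

lemma lipschitzWith_limitPath (H : IsApproxTrajectory Θ h γ C D θ) (hs : Tendsto s V atTop)
    (hx : IsLimitPath θ γ V s x) : LipschitzWith C.toNNReal x :=
  LipschitzWith.of_dist_le_mul fun t t' => by
    rw [Real.coe_toNNReal _ H.nonneg, Real.dist_eq]
    exact H.dist_limitPath_le hs hx t t'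

/-- Local form of the evolution variational inequality for limit paths.  The discrete inequalities
over a short time window add up; there the drift is controlled by its value at `x t₀`, since `θ` moves
by at most `C` per unit of time, and the noise is a Cauchy remainder. -/
lemma exists_sq_dist_sub_le (H : IsApproxTrajectory Θ h γ C D θ) (hs : Tendsto s V atTop)
    (hx : IsLimitPath θ γ V s x) {y : EuclideanSpace ℝ (Fin d)} (hy : y ∈ D) {t₀ c : ℝ}
    (hc : ⟪h (x t₀), x t₀ - y⟫ < c) :
    ∃ δ > 0, ∀ t ∈ Ioo t₀ (t₀ + δ), ‖x t - y‖ ^ 2 - ‖x t₀ - y‖ ^ 2 ≤ 2 * c * (t - t₀) := by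
  obtain ⟨r, m, hr, ⟨l, hl⟩, hrm⟩ := H.variational y hy
  obtain ⟨c₁, hc₁, hc₁c⟩ := exists_between hc
  have hxΘ : x t₀ ∈ Θ := H.clusterSet_subset (H.limitPath_mem_clusterSet hs hx t₀)
  have hφ : ContinuousWithinAt (fun v => ⟪h v, v - y⟫) Θ (x t₀) :=
    (H.continuousOn _ hxΘ).inner (continuousWithinAt_id.sub continuousWithinAt_const)
  obtain ⟨ρ, hρ, hball⟩ := Metric.mem_nhdsWithin_iff.1 (hφ.eventually_lt_const hc₁)
  have hC := H.nonneg
  refine ⟨ρ / (2 * (C + 1)), by positivity, fun t ht => ?_⟩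
  set i : ℕ → ℕ := fun n => stepAt γ (s n + t₀)
  set j : ℕ → ℕ := fun n => stepAt γ (s n + t)
  have hclock : Tendsto (fun n => clock γ (j n) - clock γ (i n)) V (𝓝 (t - t₀)) :=
    ((H.tendsto_clock_sub hs t).sub (H.tendsto_clock_sub hs t₀)).congr fun n => by ring
  have hCt : C * (t - t₀) < ρ / 2 := by
    have h1 : (t - t₀) < ρ / (2 * (C + 1)) := by linarith [ht.2]
    rw [lt_div_iff₀ (by positivity)] at h1
    nlinarith [ht.1]
  have hi := H.tendsto_stepAt_add hs t₀
  have hj := H.tendsto_stepAt_add hs t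
  refine le_of_tendsto_of_tendsto (b := (V : Filter ℕ))
    (f := fun n => ‖θ (j n) - y‖ ^ 2 - ‖θ (i n) - y‖ ^ 2)
    (g := fun n => 2 * c * (clock γ (j n) - clock γ (i n)) +
      ((∑ k ∈ Finset.range (j n), m k) - ∑ k ∈ Finset.range (i n), m k))
    ((((hx t).sub_const y).norm.pow 2).sub (((hx t₀).sub_const y).norm.pow 2)) ?_ ?_
  · simpa using (hclock.const_mul (2 * c)).add ((hl.comp hj).sub (hl.comp hi))
  have hr' := hr.eventually_lt_const (show (0 : ℝ) < 2 * (c - c₁) by linarith)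
  filter_upwards [hclock.eventually_const_lt (sub_pos.2 ht.1),
    (hclock.const_mul C).eventually_lt_const hCt,
    (hx t₀).eventually (Metric.ball_mem_nhds _ (half_pos hρ)),
    hi.eventually (eventually_forall_ge_atTop.2 hr')] with n hn1 hn2 hn3 hn4
  have hij : i n ≤ j n := ((clock_strictMono H.step_pos).lt_iff_lt.1 (by linarith)).le
  have hterm : ∀ k ∈ Finset.Ico (i n) (j n),
      ‖θ (k + 1) - y‖ ^ 2 - ‖θ k - y‖ ^ 2 ≤ 2 * c * γ k + m k := by
    intro k hk
    rw [Finset.mem_Ico] at hk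
    have hdist : dist (θ k) (x t₀) < ρ := by
      have h1 := H.dist_le hk.1
      have h2 : C * (clock γ k - clock γ (i n)) ≤ C * (clock γ (j n) - clock γ (i n)) := by
        have := (clock_strictMono H.step_pos).monotone hk.2.le
        gcongr
      have h3 : dist (θ (i n)) (x t₀) < ρ / 2 := hn3
      have h4 := dist_triangle_left (θ k) (x t₀) (θ (i n))
      linarith
    have hlt : ⟪h (θ k), θ k - y⟫ < c₁ := hball ⟨hdist, H.mem k⟩
    have := H.step_pos k
    have := hn4 k hk.1
    nlinarith [hrm k]
  have hsum := Finset.sum_le_sum hterm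
  rw [Finset.sum_Ico_sub (fun k => ‖θ k - y‖ ^ 2) hij, Finset.sum_add_distrib, ← Finset.mul_sum,
    sum_Ico_eq_clock hij, Finset.sum_Ico_eq_sub m hij] at hsum
  exact hsum

lemma inner_deriv_le (H : IsApproxTrajectory Θ h γ C D θ) (hs : Tendsto s V atTop)
    (hx : IsLimitPath θ γ V s x) {t : ℝ} (ht : DifferentiableAt ℝ x t)
    {y : EuclideanSpace ℝ (Fin d)} (hy : y ∈ Θ) : ⟪h (x t) - deriv x t, y - x t⟫ ≤ 0 := by
  -- the inequality is closed in `y`, so it suffices to test against `D`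
  suffices hD : D ⊆ {y | ⟪h (x t) - deriv x t, y - x t⟫ ≤ 0} from
    closure_minimal hD (isClosed_le (by fun_prop) continuous_const) (H.dense_test hy)
  intro y hy
  have hg : HasDerivAt (fun u => ‖x u - y‖ ^ 2) (2 * ⟪x t - y, deriv x t⟫) t :=
    (ht.hasDerivAt.sub_const y).norm_sq
  have hle : ⟪x t - y, deriv x t⟫ ≤ ⟪h (x t), x t - y⟫ := by
    refine le_of_forall_gt_imp_ge_of_dense fun c hc => ?_
    obtain ⟨δ, hδ, hle⟩ := H.exists_sq_dist_sub_le hs hx hy hc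
    have hslope := (hasDerivWithinAt_iff_tendsto_slope' self_notMem_Ioi).1
      (hg.hasDerivWithinAt (s := Ioi t))
    have : 2 * ⟪x t - y, deriv x t⟫ ≤ 2 * c := by
      refine le_of_tendsto hslope ?_
      filter_upwards [Ioo_mem_nhdsGT (show t < t + δ by linarith)] with u hu
      rw [slope_def_field, div_le_iff₀ (sub_pos.2 hu.1)]
      exact hle u hu
    linarith
  have e1 : ⟪h (x t), y - x t⟫ = -⟪h (x t), x t - y⟫ := by rw [← inner_neg_right, neg_sub]
  have e2 : ⟪deriv x t, y - x t⟫ = -⟪x t - y, deriv x t⟫ := by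
    rw [real_inner_comm, ← inner_neg_left, neg_sub]
  rw [mem_ofPred_eq, inner_sub_left, e1, e2]
  linarith

/-- Limit paths solve the projected ODE, the correction being `p = x' - h(x)`. -/
lemma isProjectedSolution_limitPath (H : IsApproxTrajectory Θ h γ C D θ) (hs : Tendsto s V atTop)
    (hx : IsLimitPath θ γ V s x) : IsProjectedSolution Θ h x := by
  have hlip := H.lipschitzWith_limitPath hs hx
  have hmem : ∀ t, x t ∈ Θ := fun t => H.clusterSet_subset (H.limitPath_mem_clusterSet hs hx t)
  have hcont : Continuous fun t => h (x t) :=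
    H.continuousOn.comp_continuous hlip.continuous hmem
  have hderiv : ∀ a b, IntervalIntegrable (deriv x) volume a b := fun a b =>
    (intervalIntegrable_const (c := (C.toNNReal : ℝ))).mono_fun
      (stronglyMeasurable_deriv x).aestronglyMeasurable
      (Eventually.of_forall fun t => by
        simpa only [Real.norm_eq_abs, abs_of_nonneg (NNReal.coe_nonneg _)] using
          norm_deriv_le_of_lipschitz hlip)
  refine ⟨hlip.continuous.continuousOn, fun t _ => hmem t, fun t => deriv x t - h (x t),
    fun t _ => (hderiv 0 t).sub (hcont.intervalIntegrable 0 t),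
    fun t _ => hcont.intervalIntegrable 0 t, fun t _ => ?_, ?_⟩
  · simp only [add_sub_cancel]
    rw [integral_deriv_of_lipschitz hlip, add_sub_cancel]
  · filter_upwards [hlip.ae_differentiableAt_real] with t ht _ y hy
    rw [neg_sub]
    exact H.inner_deriv_le hs hx ht hy

/-- Every cluster point lies on a solution inside the cluster set, at any prescribed time `T`: shift
the origin of time back by `T`. -/
lemma exists_solution_through (H : IsApproxTrajectory Θ h γ C D θ) {a : EuclideanSpace ℝ (Fin d)}
    (ha : a ∈ clusterSet θ) (T : ℝ) :
    ∃ x, IsProjectedSolution Θ h x ∧ (∀ t, x t ∈ clusterSet θ) ∧ x T = a := by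
  obtain ⟨V, hV, hθ⟩ := mapClusterPt_iff_ultrafilter.1 (show MapClusterPt a atTop θ from ha)
  have hs : Tendsto (fun n => clock γ n - T) V atTop :=
    tendsto_atTop_add_const_right _ (-T) (H.clock_tendsto.mono_left hV)
  obtain ⟨x, hx⟩ := H.exists_isLimitPath V fun n => clock γ n - T
  refine ⟨x, H.isProjectedSolution_limitPath hs hx, H.limitPath_mem_clusterSet hs hx,
    tendsto_nhds_unique (hx T) ?_⟩
  simpa [stepAt_clock H.step_pos H.clock_tendsto] using hθ

lemma isClosed_clusterSet : IsClosed (clusterSet θ) := isClosed_setOfPred_clusterPt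

lemma clusterSet_nonempty (H : IsApproxTrajectory Θ h γ C D θ) : (clusterSet θ).Nonempty :=
  let ⟨a, _, ha⟩ := H.isCompact.exists_mapClusterPt (u := θ) (f := atTop)
    (le_principal_iff.2 (mem_map.2 (univ_mem' H.mem)))
  ⟨a, ha⟩

lemma isLimitSet_clusterSet (H : IsApproxTrajectory Θ h γ C D θ) :
    IsLimitSet Θ h (clusterSet θ) := by
  refine ⟨{x | IsProjectedSolution Θ h x ∧ ∀ t, x t ∈ clusterSet θ}, ?_, fun x hx => hx.1, ?_⟩
  · obtain ⟨a, ha⟩ := H.clusterSet_nonempty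
    obtain ⟨x, h1, h2, -⟩ := H.exists_solution_through ha 0
    exact ⟨x, h1, h2⟩
  · refine Subset.antisymm (fun a ha => mem_iInter.2 fun T => mem_of_mem_of_subset ?_ subset_closure) fun a ha => ?_
    · obtain ⟨x, h1, h2, h3⟩ := H.exists_solution_through ha (max 0 T)
      exact ⟨x, ⟨h1, h2⟩, max 0 T, le_max_left _ _, le_max_right _ _, h3⟩
    · refine closure_minimal ?_ isClosed_clusterSet (mem_iInter.1 ha 0)
      rintro _ ⟨x, hx, t, -, -, rfl⟩
      exact hx.2 t

lemma tendsto_infDist_clusterSet (H : IsApproxTrajectory Θ h γ C D θ) :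
    Tendsto (fun k => Metric.infDist (θ k) (clusterSet θ)) atTop (𝓝 0) := by
  rw [tendsto_iff_ultrafilter]
  intro V hV
  obtain ⟨a, -, ha⟩ := H.isCompact.ultrafilter_le_nhds (V.map θ)
    (le_principal_iff.2 (Ultrafilter.mem_map.2 <| univ_mem' H.mem))
  have haL : a ∈ clusterSet θ := mapClusterPt_iff_ultrafilter.2 ⟨V, hV, ha⟩
  have := ((Metric.continuous_infDist_pt (clusterSet θ)).tendsto a).comp ha
  rwa [Metric.infDist_zero_of_mem haL] at this

/-- Far out, every window of the trajectory of length between `T` and `2T` has end points close to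
those of a piece of a solution inside the cluster set. -/
lemma exists_shadowing (H : IsApproxTrajectory Θ h γ C D θ) {ε : ℝ} (hε : 0 < ε) (T : ℝ) :
    ∃ u₀ : ℝ, ∀ u ≥ u₀, ∀ τ ∈ Icc T (2 * T), ∃ x, IsProjectedSolution Θ h x ∧
      (∀ t, x t ∈ clusterSet θ) ∧ dist (θ (stepAt γ u)) (x 0) < ε ∧
      dist (θ (stepAt γ (u + τ))) (x τ) < ε := by
  by_contra! hcon
  choose u hu τ hτ hbad using fun n : ℕ => hcon n
  set V : Ultrafilter ℕ := hyperfilter ℕ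
  have hV : (V : Filter ℕ) ≤ atTop := Nat.hyperfilter_le_atTop
  have hs : Tendsto u V atTop :=
    (tendsto_atTop_mono hu tendsto_natCast_atTop_atTop).mono_left hV
  obtain ⟨x, hx⟩ := H.exists_isLimitPath V u
  obtain ⟨σ, -, hσ'⟩ := isCompact_Icc.ultrafilter_le_nhds (V.map τ)
    (le_principal_iff.2 (Ultrafilter.mem_map.2 <| univ_mem' hτ))
  have hσ : Tendsto τ V (𝓝 σ) := hσ'
  -- the end time `τ n` varies with `n`; the Lipschitz bound compares it with its limit `σ`
  have h0 : Tendsto (fun n => dist (θ (stepAt γ (u n))) (x 0)) V (𝓝 0) := by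
    simpa using (hx 0).dist (tendsto_const_nhds (x := x 0))
  have h1 : Tendsto (fun n => dist (θ (stepAt γ (u n + τ n))) (x (τ n))) V (𝓝 0) := by
    have hxτ := ((H.lipschitzWith_limitPath hs hx).continuous.tendsto σ).comp hσ
    have hA : Tendsto (fun n => dist (θ (stepAt γ (u n + τ n))) (θ (stepAt γ (u n + σ)))) V
        (𝓝 0) := by
      have hB : Tendsto (fun n => u n + τ n) V atTop := hs.atTop_add hσ
      have h2 : Tendsto (fun n => clock γ (stepAt γ (u n + τ n)) - u n) V (𝓝 σ) := by
        have := ((tendsto_clock_stepAt_sub H.step_pos H.clock_tendsto H.step_tendsto).comp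
          hB).add hσ
        rw [zero_add] at this
        exact this.congr fun n => by simp only [Function.comp]; ring
      have h3 := ((h2.sub (H.tendsto_clock_sub hs σ)).abs.const_mul C)
      simp only [sub_self, abs_zero, mul_zero, sub_sub_sub_cancel_right] at h3
      exact squeeze_zero (fun _ => dist_nonneg) (fun n => H.dist_le_abs _ _) h3
    have hB := (hx σ).dist hxτ
    rw [dist_self] at hB
    have := hA.add hB
    rw [add_zero] at this
    exact squeeze_zero (fun _ => dist_nonneg) (fun n => dist_triangle _ _ _) this
  obtain ⟨n, hn0, hn1⟩ := ((h0.eventually_lt_const hε).and (h1.eventually_lt_const hε)).exists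
  exact absurd hn1 (not_lt.2 (hbad n x (H.isProjectedSolution_limitPath hs hx)
    (H.limitPath_mem_clusterSet hs hx) hn0))

/-- Follow the trajectory from a visit near `a` to a much later visit near `b`, cut the time in
between into windows of equal length in `[T, 2T]`, and shadow each of them. -/
lemma isInternallyChainTransitive_clusterSet (H : IsApproxTrajectory Θ h γ C D θ) :
    IsInternallyChainTransitive Θ h (clusterSet θ) := by
  intro a ha b hb ε hε T hT
  obtain ⟨u₀, hu₀⟩ := H.exists_shadowing (half_pos hε) T
  have visit : ∀ c ∈ clusterSet θ, ∀ v : ℝ, ∃ u ≥ v, dist (θ (stepAt γ u)) c < ε / 2 := by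
    intro c hc v
    obtain ⟨k, hk1, hk2⟩ := ((MapClusterPt.frequently (show MapClusterPt c atTop θ from hc)
      (Metric.ball_mem_nhds c (half_pos hε))).and_eventually
        (H.clock_tendsto.eventually_ge_atTop v)).exists
    exact ⟨clock γ k, hk2, by rwa [stepAt_clock H.step_pos H.clock_tendsto]⟩
  obtain ⟨u, hu, hua⟩ := visit a ha u₀
  obtain ⟨v, hv, hvb⟩ := visit b hb (u + T)
  set n : ℕ := ⌊(v - u) / T⌋₊
  have hn1 : 1 ≤ n := Nat.one_le_floor_iff _ |>.2 ((one_le_div hT).2 (by linarith))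
  have hn1' : (1 : ℝ) ≤ n := by exact_mod_cast hn1
  have hle : (n : ℝ) * T ≤ v - u :=
    (le_div_iff₀ hT).1 (Nat.floor_le (div_nonneg (by linarith) hT.le))
  have hlt : v - u < (n + 1) * T := (div_lt_iff₀ hT).1 (Nat.lt_floor_add_one _)
  set τ : ℝ := (v - u) / n
  have hnτ : n * τ = v - u := mul_div_cancel₀ _ (by positivity)
  have hτ : τ ∈ Icc T (2 * T) := by
    constructor
    · rw [le_div_iff₀ (by positivity)]; linarith
    · rw [div_le_iff₀ (by positivity)]; nlinarith
  have hτ0 : 0 < τ := hT.trans_le hτ.1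
  choose x hsol hmem hx0 hxτ using fun j : ℕ =>
    hu₀ (u + j * τ) (by have : (0 : ℝ) ≤ j * τ := by positivity
                        linarith) τ hτ
  refine ⟨n - 1, fun j => x j, fun _ => τ, fun j => ⟨hsol _, hτ.1, fun s _ => hmem _ _⟩, ?_,
    fun j => ?_, ?_⟩
  · have h1 := hx0 0
    simp only [Nat.cast_zero, zero_mul, add_zero] at h1
    have := dist_triangle_left a (x 0 0) (θ (stepAt γ u))
    simp only [Fin.val_zero]
    linarith
  · have h1 := hxτ j
    have h2 := hx0 (j + 1)
    have e : u + ((j : ℕ) + 1 : ℕ) * τ = u + (j : ℕ) * τ + τ := by push_cast; ring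
    rw [e] at h2
    have := dist_triangle_left (x j τ) (x (j + 1) 0) (θ (stepAt γ (u + (j : ℕ) * τ + τ)))
    simp only [Fin.val_castSucc, Fin.val_succ]
    linarith
  · have h1 := hxτ (n - 1)
    have e : u + ((n - 1 : ℕ) : ℝ) * τ + τ = v := by
      rw [Nat.cast_sub hn1]; push_cast; linarith
    rw [e] at h1
    have := dist_triangle_left (x (n - 1) τ) b (θ (stepAt γ v))
    simp only [Fin.val_last]
    linarith

end IsApproxTrajectory

end LimitPath

/-! ### Tracking by a scalar recursion -/

/-- A scalar Robbins–Monro recursion with convergent noise series, whose drift is at most `-c < 0`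
above each level `δ > 0`, is asymptotically nonpositive. -/
lemma eventually_le_of_drift {γ e b n : ℕ → ℝ} (hpos : ∀ k, 0 < γ k)
    (hsum : Tendsto (clock γ) atTop atTop) (hγ : Tendsto γ atTop (𝓝 0)) {B : ℝ}
    (hB : ∀ᶠ k in atTop, b k ≤ B)
    (hn : ∃ l, Tendsto (fun k => ∑ j ∈ Finset.range k, n j) atTop (𝓝 l))
    (hstep : ∀ k, e (k + 1) = e k + γ k * b k + n k)
    (hdrift : ∀ δ > 0, ∃ c > 0, ∀ᶠ k in atTop, δ ≤ e k → b k ≤ -c) {δ : ℝ} (hδ : 0 < δ) :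
    ∀ᶠ k in atTop, e k ≤ δ := by
  obtain ⟨l, hl⟩ := hn
  have hδ' : 0 < δ / 4 := by positivity
  obtain ⟨c, hc, hdr⟩ := hdrift (δ / 4) hδ'
  have hγB : Tendsto (fun k => γ k * B) atTop (𝓝 0) := by simpa using hγ.mul_const B
  -- removing the remaining noise leaves a sequence `u` without noise
  set u : ℕ → ℝ := fun k => e k - (∑ j ∈ Finset.range k, n j - l)
  have hu : ∀ k, u (k + 1) = u k + γ k * b k := fun k => by
    simp only [u, hstep, Finset.sum_range_succ]; ring
  have hclose := (Metric.tendsto_nhds.1 hl) (δ / 4) hδ'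
  obtain ⟨K, hK⟩ := eventually_atTop.1
    ((hB.and hdr).and (hclose.and (hγB.eventually_lt_const hδ')))
  have hue : ∀ k ≥ K, |u k - e k| < δ / 4 := fun k hk => by
    have := (hK k hk).2.1
    rw [Real.dist_eq] at this
    rwa [show u k - e k = -(∑ j ∈ Finset.range k, n j - l) by simp only [u]; ring, abs_neg]
  have hdown : ∀ k ≥ K, 2 * (δ / 4) ≤ u k → u (k + 1) ≤ u k - c * γ k := fun k hk h => by
    have h1 := (abs_lt.1 (hue k hk)).2
    have h2 := (hK k hk).1.2 (by linarith)
    rw [hu]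
    nlinarith [hpos k]
  have hstay : ∀ k ≥ K, u k ≤ 3 * (δ / 4) → u (k + 1) ≤ 3 * (δ / 4) := fun k hk h => by
    rcases le_or_gt (2 * (δ / 4)) (u k) with h2 | h2
    · have := hdown k hk h2
      have := mul_pos hc (hpos k)
      linarith
    · have h3 := (hK k hk).2.2
      have h4 := mul_le_mul_of_nonneg_left (hK k hk).1.1 (hpos k).le
      rw [hu]
      linarith
  obtain ⟨k₀, hk₀, hle⟩ : ∃ k ≥ K, u k ≤ 3 * (δ / 4) := by
    by_contra! hcon
    have hdec : ∀ k ≥ K, u k ≤ u K - c * (clock γ k - clock γ K) := by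
      intro k hk
      induction k, hk using Nat.le_induction with
      | base => simp
      | succ k hk ih =>
        have := hdown k hk (by linarith [hcon k hk])
        rw [clock_succ]
        linarith
    have hlim : Tendsto (fun k => c * (clock γ k - clock γ K)) atTop atTop :=
      (tendsto_atTop_add_const_right _ (-clock γ K) hsum).const_mul_atTop hc
    obtain ⟨k, hk1, hk2⟩ := ((hlim.eventually_ge_atTop (u K)).and (eventually_ge_atTop K)).exists
    linarith [hdec k hk2, hcon k hk2]
  refine eventually_atTop.2 ⟨k₀, fun k hk => ?_⟩
  have hall : u k ≤ 3 * (δ / 4) := by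
    induction k, hk using Nat.le_induction with
    | base => exact hle
    | succ k hk ih => exact hstay k (hk₀.trans hk) ih
  linarith [(abs_lt.1 (hue k (hk₀.trans hk))).1]

/-! ### Convergence of the noise -/

section Martingale

variable {Ω : Type*} [mΩ : MeasurableSpace Ω] {μ : Measure Ω}

/-- Convergence of a series of bounded martingale differences with square-summable bounds, in the
form of a process `S` centered at its conditional expectations. -/
lemma ae_tendsto_sum_sub_condExp [IsProbabilityMeasure μ] (ℱ : Filtration ℕ mΩ) {S : ℕ → Ω → ℝ}
    (hS : ∀ k, StronglyMeasurable[ℱ (k + 1)] (S k)) {c : ℕ → ℝ}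
    (hc : ∀ k, ∀ᵐ ω ∂μ, |S k ω| ≤ c k) (hsum : Summable fun k => c k ^ 2) :
    ∀ᵐ ω ∂μ, ∃ l, Tendsto (fun n => ∑ k ∈ Finset.range n, (S k ω - (μ[S k | ℱ k]) ω)) atTop
      (𝓝 l) := by
  have hSint : ∀ k, Integrable (S k) μ := fun k =>
    Integrable.of_bound ((hS k).mono (ℱ.le _)).aestronglyMeasurable (c k) (hc k)
  set D : ℕ → Ω → ℝ := fun k => S k - μ[S k | ℱ k]
  have hDmeas : ∀ k, StronglyMeasurable[ℱ (k + 1)] (D k) := fun k =>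
    (hS k).sub (stronglyMeasurable_condExp.mono (ℱ.mono k.le_succ))
  have hDint : ∀ k, Integrable (D k) μ := fun k => (hSint k).sub integrable_condExp
  have hDbdd : ∀ k, ∀ᵐ ω ∂μ, |D k ω| ≤ 2 * c k := fun k => by
    filter_upwards [hc k, ae_bdd_abs_condExp_of_ae_bdd_abs (m := ℱ k) (hc k)] with ω h2 h3
    exact (abs_sub _ _).trans (by linarith)
  have hDcond : ∀ k, μ[D k | ℱ k] =ᵐ[μ] 0 := fun k => by
    have h1 := condExp_sub (hSint k) (integrable_condExp (m := ℱ k) (f := S k) (μ := μ)) (ℱ k)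
    have h2 : μ[μ[S k | ℱ k] | ℱ k] = μ[S k | ℱ k] :=
      condExp_of_stronglyMeasurable (ℱ.le k) stronglyMeasurable_condExp integrable_condExp
    filter_upwards [h1] with ω h
    rw [h, h2]
    simp
  set P : ℕ → Ω → ℝ := fun n => ∑ k ∈ Finset.range n, D k
  have hPmeas : ∀ n, StronglyMeasurable[ℱ n] (P n) := fun n =>
    Finset.stronglyMeasurable_sum _ fun k hk =>
      (hDmeas k).mono (ℱ.mono (Finset.mem_range.1 hk))
  have hPbdd : ∀ n, ∃ R, ∀ᵐ ω ∂μ, |P n ω| ≤ R := fun n => by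
    refine ⟨∑ k ∈ Finset.range n, 2 * c k, ?_⟩
    filter_upwards [ae_all_iff.2 hDbdd] with ω h
    simp only [P, Finset.sum_apply]
    exact (Finset.abs_sum_le_sum_abs _ _).trans (Finset.sum_le_sum fun k _ => h k)
  have hPint : ∀ n, Integrable (P n) μ := fun n => integrable_finsetSum' _ fun k _ => hDint k
  have hPsucc : ∀ n, P (n + 1) = P n + D n := fun n => Finset.sum_range_succ _ _
  have hmart : Martingale P ℱ μ :=
    martingale_of_condExp_sub_eq_zero_nat hPmeas hPint fun i => by
      rw [hPsucc, add_sub_cancel_left]; exact hDcond i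
  have hPsqint : ∀ n, Integrable (fun ω => P n ω ^ 2) μ := fun n => by
    obtain ⟨R, hR⟩ := hPbdd n
    refine Integrable.of_bound (((hPmeas n).mono (ℱ.le _)).aestronglyMeasurable.pow 2) (R ^ 2) ?_
    filter_upwards [hR] with ω h
    rw [Real.norm_eq_abs, abs_pow]
    gcongr
  have hcross : ∀ n, Integrable (fun ω => P n ω * D n ω) μ ∧ ∫ ω, P n ω * D n ω ∂μ = 0 := fun n => by
    obtain ⟨R, hR⟩ := hPbdd n
    refine ⟨(hDint n).bdd_mul ((hPmeas n).mono (ℱ.le _)).aestronglyMeasurable (c := R) hR, ?_⟩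
    have h1 := condExp_stronglyMeasurable_mul_of_bound (ℱ.le n) (hPmeas n) (hDint n) R hR
    rw [← integral_condExp (ℱ.le n)]
    refine integral_eq_zero_of_ae ?_
    filter_upwards [h1, hDcond n] with ω h2 h3
    change (μ[P n * D n | ℱ n]) ω = 0
    rw [h2, Pi.mul_apply, h3, Pi.zero_apply, mul_zero]
  have hDsqint : ∀ n, Integrable (fun ω => D n ω ^ 2) μ ∧ ∫ ω, D n ω ^ 2 ∂μ ≤ 4 * c n ^ 2 :=
    fun n => by
    have hb : ∀ᵐ ω ∂μ, D n ω ^ 2 ≤ 4 * c n ^ 2 := by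
      filter_upwards [hDbdd n] with ω h
      have := sq_le_sq' (abs_le.1 h).1 (abs_le.1 h).2
      linarith
    have hint : Integrable (fun ω => D n ω ^ 2) μ := by
      refine Integrable.of_bound (((hDmeas n).mono (ℱ.le _)).aestronglyMeasurable.pow 2)
        (4 * c n ^ 2) ?_
      filter_upwards [hb] with ω h
      rwa [Real.norm_eq_abs, abs_of_nonneg (sq_nonneg _)]
    exact ⟨hint, (integral_mono_ae hint (integrable_const _) hb).trans (by simp)⟩
  have hPsq : ∀ n, ∫ ω, P n ω ^ 2 ∂μ ≤ ∑ k ∈ Finset.range n, 4 * c k ^ 2 := by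
    intro n
    induction n with
    | zero => simp [P]
    | succ n ih =>
      have hexp : (fun ω => P (n + 1) ω ^ 2)
          = fun ω => (P n ω ^ 2 + 2 * (P n ω * D n ω)) + D n ω ^ 2 := by
        funext ω; rw [hPsucc, Pi.add_apply]; ring
      have h1 : Integrable (fun ω => 2 * (P n ω * D n ω)) μ := (hcross n).1.const_mul 2
      have h2 : Integrable (fun ω => P n ω ^ 2 + 2 * (P n ω * D n ω)) μ := (hPsqint n).add h1
      rw [hexp, integral_add h2 (hDsqint n).1, integral_add (hPsqint n) h1, integral_const_mul,
        (hcross n).2, Finset.sum_range_succ]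
      linarith [(hDsqint n).2]
  have hL1 : ∀ n, eLpNorm (P n) 1 μ ≤ (1 + ∑' k, 4 * c k ^ 2).toNNReal := fun n => by
    rw [eLpNorm_one_eq_lintegral_enorm, ← ofReal_integral_norm_eq_lintegral_enorm (hPint n)]
    refine ENNReal.ofReal_le_ofReal ?_
    have h1 : ∫ ω, ‖P n ω‖ ∂μ ≤ ∫ ω, (1 + P n ω ^ 2) ∂μ :=
      integral_mono (hPint n).norm ((integrable_const _).add (hPsqint n)) fun ω => by
        simp only [Real.norm_eq_abs]
        nlinarith [sq_nonneg (|P n ω| - 1), sq_abs (P n ω), abs_nonneg (P n ω)]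
    rw [integral_add (integrable_const _) (hPsqint n)] at h1
    have h2 := (hsum.mul_left 4).sum_le_tsum (Finset.range n) fun k _ => by positivity
    have h3 := hPsq n
    simp only [integral_const, probReal_univ, one_smul] at h1
    linarith
  filter_upwards [hmart.submartingale.exists_ae_tendsto_of_bdd hL1] with ω ⟨l, hl⟩
  exact ⟨l, by simpa [P, D] using hl⟩

open ProbabilityTheory in
/-- If `X` has conditional law `κ (Z ·)` given `m`, and `Z` is `m`-measurable, then conditional
expectations given `m` of functions of `(Z, X)` are computed by freezing `Z`. -/
lemma condExp_comp_eq_integral_kernel {Ω α β : Type*} [MeasurableSpace α]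
    [MeasurableSpace β] {m mΩ : MeasurableSpace Ω} {μ : Measure Ω} (hm : m ≤ mΩ) [IsProbabilityMeasure μ] {X : Ω → α} {Z : Ω → β}
    (hX : Measurable X) (hZ : Measurable[m] Z) (κ : Kernel β α) [IsMarkovKernel κ]
    (hκ : ∀ A, MeasurableSet A →
      μ[(X ⁻¹' A).indicator (fun _ => (1 : ℝ)) | m] =ᵐ[μ] fun ω => (κ (Z ω)).real A)
    {φ : β × α → ℝ} (hφ : Measurable φ) {B : ℝ} (hB : ∀ p, |φ p| ≤ B) :
    μ[fun ω => φ (Z ω, X ω) | m] =ᵐ[μ] fun ω => ∫ a, φ (Z ω, a) ∂κ (Z ω) := by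
  have hZ' : Measurable Z := hZ.mono hm le_rfl
  have hZX : Measurable fun ω => (Z ω, X ω) := hZ'.prodMk hX
  have hreal : ∀ A, MeasurableSet A → Measurable fun b => (κ b).real A := fun A hA =>
    (κ.measurable_coe hA).ennreal_toReal
  have hlaw : ∀ s, MeasurableSet[m] s →
      (μ.restrict s).map (fun ω => (Z ω, X ω)) = ((μ.restrict s).map Z) ⊗ₘ κ := by
    intro s hs
    have hs' := hm s hs
    refine Measure.ext_prod fun {D A} hD hA => ?_
    have hsD : MeasurableSet[m] (s ∩ Z ⁻¹' D) := hs.inter (hZ hD)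
    have hint : Integrable ((X ⁻¹' A).indicator fun _ => (1 : ℝ)) μ :=
      (integrable_const _).indicator (hX hA)
    have h1 : ∫ ω in s ∩ Z ⁻¹' D, (κ (Z ω)).real A ∂μ = μ.real (s ∩ Z ⁻¹' D ∩ X ⁻¹' A) := by
      rw [← setIntegral_congr_ae (g := fun ω => (κ (Z ω)).real A) (hm _ hsD)
        ((hκ A hA).mono fun ω h _ => h), setIntegral_condExp hm hint hsD,
        setIntegral_indicator (hX hA)]
      simp
    rw [Measure.map_apply hZX (hD.prod hA), Measure.compProd_apply_prod hD hA,
      setLIntegral_map hD (κ.measurable_coe hA) hZ', Measure.restrict_restrict (hZ' hD),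
      Measure.restrict_apply (hZX (hD.prod hA)), inter_comm (Z ⁻¹' D)]
    have h2 : ∫⁻ ω in s ∩ Z ⁻¹' D, κ (Z ω) A ∂μ
        = ENNReal.ofReal (∫ ω in s ∩ Z ⁻¹' D, (κ (Z ω)).real A ∂μ) := by
      rw [ofReal_integral_eq_lintegral_ofReal]
      · simp [Measure.real]
      · exact Integrable.of_bound ((hreal A hA).comp hZ').aestronglyMeasurable 1
          (Eventually.of_forall fun ω => by
            rw [Real.norm_eq_abs]
            exact (abs_of_nonneg measureReal_nonneg).trans_le measureReal_le_one)
      · exact Eventually.of_forall fun ω => measureReal_nonneg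
    rw [h2, h1, ofReal_measureReal]
    congr 1
    ext ω
    simp only [mem_inter_iff, mem_preimage, mem_prod]
    tauto
  have hsm : StronglyMeasurable fun b => ∫ a, φ (b, a) ∂κ b :=
    hφ.stronglyMeasurable.integral_kernel_prod_right'
  have hbd : ∀ b, ‖∫ a, φ (b, a) ∂κ b‖ ≤ B := fun b => by
    simpa using norm_integral_le_of_norm_le_const (μ := κ b) (f := fun a => φ (b, a))
      (Eventually.of_forall fun a => hB (b, a))
  have hgm : StronglyMeasurable[m] fun ω => ∫ a, φ (Z ω, a) ∂κ (Z ω) := hsm.comp_measurable hZ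
  refine (ae_eq_condExp_of_forall_setIntegral_eq hm ?_ (fun s _ _ => ?_) (fun s hs _ => ?_)
    hgm.aestronglyMeasurable).symm
  · exact Integrable.of_bound (hφ.comp hZX).aestronglyMeasurable B
      (Eventually.of_forall fun ω => hB _)
  · exact (Integrable.of_bound (hgm.mono hm).aestronglyMeasurable B
      (Eventually.of_forall fun ω => hbd _)).integrableOn
  · have h1 : ∫ ω in s, φ (Z ω, X ω) ∂μ = ∫ p, φ p ∂((μ.restrict s).map fun ω => (Z ω, X ω)) :=
      (integral_map hZX.aemeasurable hφ.aestronglyMeasurable).symm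
    rw [h1, hlaw s hs, Measure.integral_compProd
      (Integrable.of_bound hφ.aestronglyMeasurable B (Eventually.of_forall hB)),
      integral_map hZ'.aemeasurable hsm.aestronglyMeasurable]

end Martingale

namespace Model

variable {d m : ℕ} (M : Model d m)

/-! ### Distribution function and quantiles of the observable -/

lemma integrableOn_fX {θ : EuclideanSpace ℝ (Fin d)} (hθ : θ ∈ M.U) :
    IntegrableOn (fun x => M.fX x θ) M.𝒳 :=
  integrable_of_integral_eq_one (M.fX_integral θ hθ)

lemma measurable_fX_left (θ : EuclideanSpace ℝ (Fin d)) : Measurable fun x => M.fX x θ :=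
  M.measurable_fX.comp (measurable_id.prodMk measurable_const)

lemma measurableSet_sublevel (y : ℝ) : MeasurableSet {x | M.𝓛 x ≤ y} :=
  measurableSet_le M.measurable_𝓛 measurable_const

lemma fX_nonneg_ae {θ : EuclideanSpace ℝ (Fin d)} (hθ : θ ∈ M.U) {A : Set (EuclideanSpace ℝ (Fin m))}
    (hA : A ⊆ M.𝒳) (hAm : MeasurableSet A) : 0 ≤ᵐ[volume.restrict A] fun x => M.fX x θ :=
  (ae_restrict_mem hAm).mono fun x hx => (M.fX_pos x (hA hx) θ hθ).le

lemma cdf_mono {θ : EuclideanSpace ℝ (Fin d)} (hθ : θ ∈ M.U) : Monotone fun y => M.cdf y θ :=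
  fun _ y' hyy' => setIntegral_mono_set
    ((M.integrableOn_fX hθ).mono_set inter_subset_left)
    (M.fX_nonneg_ae hθ inter_subset_left (M.measurableSet_𝒳.inter (M.measurableSet_sublevel y')))
    (LE.le.eventuallyLE (inter_subset_inter_right _ fun _ hx => le_trans hx hyy'))

lemma cdf_nonneg {θ : EuclideanSpace ℝ (Fin d)} (hθ : θ ∈ M.U) (y : ℝ) : 0 ≤ M.cdf y θ :=
  integral_nonneg_of_ae (M.fX_nonneg_ae hθ inter_subset_left
    (M.measurableSet_𝒳.inter (M.measurableSet_sublevel y)))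

lemma cdf_le_one {θ : EuclideanSpace ℝ (Fin d)} (hθ : θ ∈ M.U) (y : ℝ) : M.cdf y θ ≤ 1 := by
  rw [← M.fX_integral θ hθ]
  exact setIntegral_mono_set (M.integrableOn_fX hθ)
    (M.fX_nonneg_ae hθ Subset.rfl M.measurableSet_𝒳)
    (LE.le.eventuallyLE inter_subset_left)

lemma exists_le_cdf {θ : EuclideanSpace ℝ (Fin d)} (hθ : θ ∈ M.U) {z : ℝ} (hz : z < 1) :
    ∃ y, z ≤ M.cdf y θ := by
  have hU : ⋃ n : ℕ, M.𝒳 ∩ {x | M.𝓛 x ≤ n} = M.𝒳 := by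
    rw [← inter_iUnion, inter_eq_left]
    exact fun x _ => mem_iUnion.2 (exists_nat_ge (M.𝓛 x))
  have h := tendsto_setIntegral_of_monotone (μ := volume) (f := fun x => M.fX x θ)
    (s := fun n : ℕ => M.𝒳 ∩ {x | M.𝓛 x ≤ n})
    (fun n => M.measurableSet_𝒳.inter (M.measurableSet_sublevel n))
    (fun i j hij => inter_subset_inter_right _ fun x (hx : M.𝓛 x ≤ i) =>
      hx.trans (Nat.cast_le.2 hij)) (by rw [hU]; exact M.integrableOn_fX hθ)
  rw [hU, M.fX_integral θ hθ] at h
  obtain ⟨n, hn⟩ := (h.eventually_const_lt hz).exists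
  exact ⟨n, hn.le⟩

lemma exists_cdf_lt {θ : EuclideanSpace ℝ (Fin d)} (hθ : θ ∈ M.U) {z : ℝ} (hz : 0 < z) :
    ∃ y, M.cdf y θ < z := by
  have hI : ⋂ n : ℕ, M.𝒳 ∩ {x | M.𝓛 x ≤ -(n : ℝ)} = ∅ := by
    refine eq_empty_of_forall_notMem fun x hx => ?_
    obtain ⟨n, hn⟩ := exists_nat_gt (-M.𝓛 x)
    have : M.𝓛 x ≤ -(n : ℝ) := (mem_iInter.1 hx n).2
    linarith
  have h := tendsto_setIntegral_of_antitone (μ := volume) (f := fun x => M.fX x θ)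
    (s := fun n : ℕ => M.𝒳 ∩ {x | M.𝓛 x ≤ -(n : ℝ)})
    (fun n => M.measurableSet_𝒳.inter (M.measurableSet_sublevel _))
    (fun i j hij => inter_subset_inter_right _ fun x (hx : M.𝓛 x ≤ -(j : ℝ)) =>
      hx.trans (neg_le_neg (Nat.cast_le.2 hij)))
    ⟨0, (M.integrableOn_fX hθ).mono_set inter_subset_left⟩
  rw [hI, setIntegral_empty] at h
  obtain ⟨n, hn⟩ := (h.eventually_lt_const hz).exists
  exact ⟨-n, hn⟩

lemma le_cdf_of_quantile_lt {θ : EuclideanSpace ℝ (Fin d)} (hθ : θ ∈ M.U) {z y : ℝ}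
    (hz : z < 1) (h : M.quantile z θ < y) : z ≤ M.cdf y θ := by
  obtain ⟨y', hy', hlt⟩ := exists_lt_of_csInf_lt (M.exists_le_cdf hθ hz) h
  exact le_trans hy' (M.cdf_mono hθ hlt.le)

lemma cdf_lt_of_lt_quantile {θ : EuclideanSpace ℝ (Fin d)} (hθ : θ ∈ M.U) {z y : ℝ}
    (hz : 0 < z) (h : y < M.quantile z θ) : M.cdf y θ < z := by
  obtain ⟨y₀, hy₀⟩ := M.exists_cdf_lt hθ hz
  by_contra! hle
  refine absurd (csInf_le ⟨y₀, fun y' (hy' : z ≤ M.cdf y' θ) => ?_⟩ hle) (not_le.2 h)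
  by_contra! hlt
  exact absurd (M.cdf_mono hθ hlt.le) (not_le.2 (hy₀.trans_le hy'))

variable {M}

lemma SmoothQuantiles.continuousOn_quantile (hM : M.SmoothQuantiles) {z : ℝ}
    (hz : z ∈ Ioo (0 : ℝ) 1) : ContinuousOn (M.quantile z) M.Θ :=
  hM.quantile_continuous.comp (f := fun θ => (z, θ)) (by fun_prop) fun _ hθ => ⟨hz, hθ⟩

/-- Away from the `z`-quantile, the distribution function differs from `z` by a margin uniform in
`θ ∈ Θ`.  This uses the continuity of the quantile in its level: by compactness, the quantiles of
levels `z ± η` are within `δ` of the `z`-quantile. -/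
lemma SmoothQuantiles.exists_cdf_gap (hM : M.SmoothQuantiles) {z : ℝ} (hz : z ∈ Ioo (0 : ℝ) 1)
    {δ : ℝ} (hδ : 0 < δ) : ∃ η > 0, ∀ θ ∈ M.Θ, ∀ y,
      (M.quantile z θ + δ ≤ y → z + η ≤ M.cdf y θ) ∧
      (y ≤ M.quantile z θ - δ → M.cdf y θ ≤ z - η) := by
  obtain ⟨ρ, hρ, hsub⟩ := Metric.isOpen_iff.1 isOpen_Ioo z hz
  have hsub' : Icc (z - ρ / 2) (z + ρ / 2) ⊆ Ioo 0 1 := fun t ht => hsub (by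
    rw [Metric.mem_ball, Real.dist_eq, abs_lt]; constructor <;> linarith [ht.1, ht.2])
  have huc := (isCompact_Icc (a := z - ρ / 2) (b := z + ρ / 2)).prod M.isCompact_Θ
    |>.uniformContinuousOn_of_continuous
      (hM.quantile_continuous.mono (prod_mono_left hsub'))
  obtain ⟨κ, hκ, huc⟩ := Metric.uniformContinuousOn_iff.1 huc δ hδ
  set η := min (ρ / 2) (κ / 2)
  have hη : 0 < η := lt_min (half_pos hρ) (half_pos hκ)
  have hηρ : η ≤ ρ / 2 := min_le_left _ _
  have hηκ : η < κ := (min_le_right _ _).trans_lt (half_lt_self hκ)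
  have hclose : ∀ θ ∈ M.Θ, ∀ t, |t - z| ≤ η → |M.quantile t θ - M.quantile z θ| < δ := by
    intro θ hθ t ht
    have ht' := abs_le.1 ht
    have := huc (t, θ) ⟨⟨by linarith [ht'.1], by linarith [ht'.2]⟩, hθ⟩ (z, θ)
      ⟨⟨by linarith, by linarith⟩, hθ⟩
      (by rw [Prod.dist_eq, dist_self, max_eq_left dist_nonneg, Real.dist_eq]; linarith)
    rwa [Real.dist_eq] at this
  refine ⟨η, hη, fun θ hθ y => ⟨fun hy => ?_, fun hy => ?_⟩⟩
  · have h1 := (abs_lt.1 (hclose θ hθ (z + η) (by simp [abs_of_pos hη]))).2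
    exact M.le_cdf_of_quantile_lt (M.subset_U hθ)
      (hsub' ⟨by linarith, by linarith⟩ : z + η ∈ Ioo (0 : ℝ) 1).2 (by linarith)
  · have h1 := (abs_lt.1 (hclose θ hθ (z - η) (by simp [abs_of_pos hη]))).1
    exact (M.cdf_lt_of_lt_quantile (M.subset_U hθ)
      (hsub' ⟨by linarith, by linarith⟩ : z - η ∈ Ioo (0 : ℝ) 1).1 (by linarith)).le

lemma SmoothQuantiles.exists_abs_quantile_le (hM : M.SmoothQuantiles) {z : ℝ}
    (hz : z ∈ Ioo (0 : ℝ) 1) : ∃ R : ℝ, ∀ θ ∈ M.Θ, |M.quantile z θ| ≤ R :=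
  M.isCompact_Θ.exists_bound_of_continuousOn (hM.continuousOn_quantile hz)

lemma SmoothQuantiles.exists_lipschitz_quantile (hM : M.SmoothQuantiles) {z : ℝ}
    (hz : z ∈ Ioo (0 : ℝ) 1) : ∃ K : ℝ, ∀ θ ∈ M.Θ, ∀ θ' ∈ M.Θ,
      |M.quantile z θ' - M.quantile z θ| ≤ K * dist θ θ' := by
  have hcont : ContinuousOn (M.gradQuantile z) M.Θ :=
    hM.gradQuantile_continuous.comp (f := fun θ => (z, θ)) (by fun_prop) fun _ hθ => ⟨hz, hθ⟩
  obtain ⟨K, hK⟩ := M.isCompact_Θ.exists_bound_of_continuousOn hcont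
  refine ⟨K, fun θ hθ θ' hθ' => ?_⟩
  have := M.convex_Θ.norm_image_sub_le_of_norm_hasFDerivWithin_le
    (f := fun ϑ => M.quantile z ϑ)
    (fun ϑ hϑ => (hM.quantile_differentiable z hz ϑ hϑ).hasGradientAt.hasFDerivAt.hasFDerivWithinAt)
    (fun ϑ hϑ => by rw [LinearIsometryEquiv.norm_map]; exact hK ϑ hϑ) hθ hθ'
  rwa [Real.norm_eq_abs, ← dist_eq_norm, dist_comm] at this

lemma SmoothQuantiles.continuousOn_gradJ (hM : M.SmoothQuantiles) {N : ℕ} (w : ℝ → ℝ)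
    {z : Fin (N + 1) → ℝ} (hz : IsGrid z) : ContinuousOn (M.gradJ w z) M.Θ := by
  refine continuousOn_finsetSum _ fun i _ => ContinuousOn.fun_smul ?_ ?_
  · exact continuousOn_const.mul ((hM.continuousOn_quantile (hz.mem_Ioo _)).sub
      (hM.continuousOn_quantile (hz.mem_Ioo _)))
  · exact hM.gradCdf_continuous.comp
      (f := fun θ => (M.quantile (z i.succ) θ, θ))
      ((hM.continuousOn_quantile (hz.mem_Ioo _)).prodMk continuousOn_id)
      fun _ hθ => ⟨mem_univ _, hθ⟩

/-! ### The score function and the gradient of the distribution function -/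

lemma hasFDerivAt_log_fX {x : EuclideanSpace ℝ (Fin m)} (hx : x ∈ M.𝒳)
    {θ : EuclideanSpace ℝ (Fin d)} (hθ : θ ∈ M.Θ) :
    HasFDerivAt (fun ϑ => Real.log (M.fX x ϑ))
      (InnerProductSpace.toDual ℝ (EuclideanSpace ℝ (Fin d)) (M.score x θ)) θ :=
  ((M.fX_differentiable x hx θ hθ).log
    (M.fX_pos x hx θ (M.subset_U hθ)).ne').hasGradientAt.hasFDerivAt

lemma abs_log_fX_sub_le {C : ℝ} (hC : ∀ x ∈ M.𝒳, ∀ θ ∈ M.Θ, ‖M.score x θ‖ ≤ C)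
    {x : EuclideanSpace ℝ (Fin m)} (hx : x ∈ M.𝒳) {θ θ' : EuclideanSpace ℝ (Fin d)}
    (hθ : θ ∈ M.Θ) (hθ' : θ' ∈ M.Θ) :
    |Real.log (M.fX x θ') - Real.log (M.fX x θ)| ≤ C * ‖θ' - θ‖ :=
  M.convex_Θ.norm_image_sub_le_of_norm_hasFDerivWithin_le
    (f := fun ϑ => Real.log (M.fX x ϑ))
    (fun _ hϑ => (hasFDerivAt_log_fX hx hϑ).hasFDerivWithinAt)
    (fun ϑ hϑ => by rw [LinearIsometryEquiv.norm_map]; exact hC x hx ϑ hϑ) hθ hθ'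

lemma tendsto_norm_natCast_add_one : Tendsto (fun n : ℕ => ‖(n : ℝ) + 1‖) atTop atTop :=
  tendsto_norm_atTop_atTop.comp (tendsto_atTop_add_const_right _ 1 tendsto_natCast_atTop_atTop)

lemma add_inv_smul_sub_mem (M : Model d m) {θ v : EuclideanSpace ℝ (Fin d)} (hθ : θ ∈ M.Θ)
    (hv : v ∈ M.Θ) (n : ℕ) : θ + ((n : ℝ) + 1)⁻¹ • (v - θ) ∈ M.Θ :=
  M.convex_Θ.add_smul_sub_mem hθ hv ⟨by positivity, inv_le_one_of_one_le₀ (by simp)⟩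

lemma tendsto_log_quotient {x : EuclideanSpace ℝ (Fin m)} (hx : x ∈ M.𝒳)
    {θ : EuclideanSpace ℝ (Fin d)} (hθ : θ ∈ M.Θ) (v : EuclideanSpace ℝ (Fin d)) :
    Tendsto (fun n : ℕ => ((n : ℝ) + 1) *
      (Real.log (M.fX x (θ + ((n : ℝ) + 1)⁻¹ • (v - θ))) - Real.log (M.fX x θ))) atTop
      (𝓝 ⟪M.score x θ, v - θ⟫) := by
  simpa using (hasFDerivAt_log_fX hx hθ).lim (v - θ) tendsto_norm_natCast_add_one

variable (M) in
/-- The component of the score in the direction of `v ∈ Θ`, as a function of `(θ, x)`, set to `0`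
outside `Θ × 𝒳`, where the score is not controlled. -/
noncomputable def scoreToward (v : EuclideanSpace ℝ (Fin d)) :
    EuclideanSpace ℝ (Fin d) × EuclideanSpace ℝ (Fin m) → ℝ :=
  (M.Θ ×ˢ M.𝒳).indicator fun p => ⟪M.score p.2 p.1, v - p.1⟫

/-- Only directions that point into `Θ` are considered: there the score is a limit of difference
quotients of the jointly measurable density. -/
lemma measurable_scoreToward {v : EuclideanSpace ℝ (Fin d)} : Measurable (M.scoreToward v) := by
  have hT : MeasurableSet (M.Θ ×ˢ M.𝒳) :=
    M.isCompact_Θ.isClosed.measurableSet.prod M.measurableSet_𝒳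
  refine measurable_of_tendsto_metrizable (f := fun n : ℕ => (M.Θ ×ˢ M.𝒳).indicator fun p =>
    ((n : ℝ) + 1) * (Real.log (M.fX p.2 (p.1 + ((n : ℝ) + 1)⁻¹ • (v - p.1)))
      - Real.log (M.fX p.2 p.1))) (fun n => Measurable.indicator ?_ hT) ?_
  · refine measurable_const.mul (Measurable.sub ?_ ?_)
    · exact Real.measurable_log.comp (M.measurable_fX.comp
        (measurable_snd.prodMk (by fun_prop)))
    · exact Real.measurable_log.comp (M.measurable_fX.comp
        (measurable_snd.prodMk measurable_fst))
  · rw [tendsto_pi_nhds]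
    intro p
    by_cases hp : p ∈ M.Θ ×ˢ M.𝒳
    · simp only [scoreToward, indicator_of_mem hp]
      exact tendsto_log_quotient hp.2 hp.1 v
    · simp only [scoreToward, indicator_of_notMem hp]
      exact tendsto_const_nhds

lemma abs_scoreToward_le {C : ℝ} (hC0 : 0 ≤ C)
    (hC : ∀ x ∈ M.𝒳, ∀ θ ∈ M.Θ, ‖M.score x θ‖ ≤ C) {v : EuclideanSpace ℝ (Fin d)} (hv : v ∈ M.Θ)
    (p : EuclideanSpace ℝ (Fin d) × EuclideanSpace ℝ (Fin m)) :
    |M.scoreToward v p| ≤ C * Metric.diam M.Θ := by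
  by_cases hp : p ∈ M.Θ ×ˢ M.𝒳
  · rw [scoreToward, indicator_of_mem hp]
    refine (abs_real_inner_le_norm _ _).trans (mul_le_mul (hC _ hp.2 _ hp.1) ?_ (norm_nonneg _) hC0)
    rw [← dist_eq_norm]
    exact Metric.dist_le_diam_of_mem M.isCompact_Θ.isBounded hv hp.1
  · rw [scoreToward, indicator_of_notMem hp, abs_zero]
    exact mul_nonneg hC0 Metric.diam_nonneg

lemma abs_exp_sub_one_le_mul_exp {t a : ℝ} (h : |t| ≤ a) : |Real.exp t - 1| ≤ |t| * Real.exp a := by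
  rcases le_total 0 t with ht | ht
  · rw [abs_of_nonneg ht] at *
    rw [abs_of_nonneg (by linarith [Real.add_one_le_exp t])]
    have h1 := Real.add_one_le_exp (-t)
    have h2 : Real.exp t * Real.exp (-t) = 1 := by rw [← Real.exp_add]; simp
    have h3 : Real.exp t ≤ Real.exp a := Real.exp_le_exp.2 h
    nlinarith [Real.exp_pos t]
  · have h1 := Real.add_one_le_exp t
    have h2 : 1 ≤ Real.exp a := Real.one_le_exp ((abs_nonneg t).trans h)
    have h3 : Real.exp t ≤ 1 := Real.exp_le_one_iff.2 ht
    rw [abs_of_nonpos (by linarith), abs_of_nonpos ht]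
    nlinarith

/-- Differentiation under the integral sign, in a direction that points into `Θ`: bounded scores make
the densities along the segment comparable up to a constant factor, so that the difference quotients
are dominated. -/
lemma setIntegral_fX_mul_scoreToward (hM : M.SmoothQuantiles) (hscore : M.BoundedScore)
    {θ v : EuclideanSpace ℝ (Fin d)} (hθ : θ ∈ M.Θ) (hv : v ∈ M.Θ) (y : ℝ) :
    ∫ x in M.𝒳 ∩ {x | M.𝓛 x ≤ y}, M.fX x θ * M.scoreToward v (θ, x)
      = ⟪M.gradCdf y θ, v - θ⟫ := by
  obtain ⟨C, hC0, hC⟩ := hscore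
  set A : Set (EuclideanSpace ℝ (Fin m)) := M.𝒳 ∩ {x | M.𝓛 x ≤ y}
  have hA : MeasurableSet A := M.measurableSet_𝒳.inter (M.measurableSet_sublevel y)
  set ϑ : ℕ → EuclideanSpace ℝ (Fin d) := fun n => θ + ((n : ℝ) + 1)⁻¹ • (v - θ)
  have hϑ : ∀ n, ϑ n ∈ M.Θ := M.add_inv_smul_sub_mem hθ hv
  set a : ℝ := C * ‖v - θ‖
  have ha : 0 ≤ a := by positivity
  have hϑsub : ∀ n : ℕ, ‖ϑ n - θ‖ = ((n : ℝ) + 1)⁻¹ * ‖v - θ‖ := fun n => by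
    simp only [ϑ, add_sub_cancel_left, norm_smul, norm_inv, Real.norm_eq_abs]
    rw [abs_of_pos (by positivity : (0 : ℝ) < (n : ℝ) + 1)]
  have hint : ∀ ϑ ∈ M.Θ, IntegrableOn (fun x => M.fX x ϑ) A := fun ϑ hϑ =>
    (M.integrableOn_fX (M.subset_U hϑ)).mono_set inter_subset_left
  have hlim1 : Tendsto (fun n : ℕ => ∫ x in A, ((n : ℝ) + 1) * (M.fX x (ϑ n) - M.fX x θ)) atTop
      (𝓝 ⟪M.gradCdf y θ, v - θ⟫) := by
    have h := (hM.cdf_differentiable_param y θ hθ).hasGradientAt.hasFDerivAt.lim (v - θ)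
      tendsto_norm_natCast_add_one
    rw [InnerProductSpace.toDual_apply_apply] at h
    refine h.congr fun n => ?_
    rw [integral_const_mul, integral_sub (hint _ (hϑ n)) (hint _ hθ)]
    rfl
  refine tendsto_nhds_unique (tendsto_integral_of_dominated_convergence
    (fun x => M.fX x θ * (a * Real.exp a)) (fun n => ?_) ?_ (fun n => ?_) ?_) hlim1
  · exact (measurable_const.mul ((M.measurable_fX_left _).sub
      (M.measurable_fX_left _))).aestronglyMeasurable
  · exact (hint θ hθ).mul_const _
  · filter_upwards [ae_restrict_mem hA] with x hx
    have hpos := M.fX_pos x hx.1 θ (M.subset_U hθ)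
    have hposn := M.fX_pos x hx.1 _ (M.subset_U (hϑ n))
    set t := Real.log (M.fX x (ϑ n)) - Real.log (M.fX x θ)
    have ht : |t| ≤ ((n : ℝ) + 1)⁻¹ * a := by
      have := abs_log_fX_sub_le hC hx.1 hθ (hϑ n)
      rw [hϑsub] at this
      exact this.trans_eq (by ring)
    have hta : |t| ≤ a := ht.trans (mul_le_of_le_one_left ha (inv_le_one_of_one_le₀ (by simp)))
    have hexp : M.fX x (ϑ n) - M.fX x θ = M.fX x θ * (Real.exp t - 1) := by
      rw [Real.exp_sub, Real.exp_log hpos, Real.exp_log hposn]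
      field_simp
    have h1 := abs_exp_sub_one_le_mul_exp hta
    rw [hexp, Real.norm_eq_abs, abs_mul, abs_mul, abs_of_pos hpos,
      abs_of_pos (by positivity : (0 : ℝ) < (n : ℝ) + 1)]
    calc ((n : ℝ) + 1) * (M.fX x θ * |Real.exp t - 1|)
        ≤ ((n : ℝ) + 1) * (M.fX x θ * ((((n : ℝ) + 1)⁻¹ * a) * Real.exp a)) := by
          gcongr
          exact h1.trans (by gcongr)
      _ = M.fX x θ * (a * Real.exp a) := by field_simp
  · filter_upwards [ae_restrict_mem hA] with x hx
    have hpos := M.fX_pos x hx.1 θ (M.subset_U hθ)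
    have h := (hasFDerivAt_log_fX hx.1 hθ).exp.lim (v - θ) tendsto_norm_natCast_add_one
    rw [Real.exp_log hpos] at h
    rw [scoreToward, indicator_of_mem (show (θ, x) ∈ M.Θ ×ˢ M.𝒳 from ⟨hθ, hx.1⟩)]
    refine h.congr fun n => ?_
    rw [Real.exp_log (M.fX_pos x hx.1 _ (M.subset_U (hϑ n))), smul_eq_mul]

/-! ### The law of the input as a Markov kernel -/

open ProbabilityTheory

open Classical in
/-- A retraction of the parameter space onto `Θ`: parameters outside `Θ` are sent to a fixed element
of `Θ`. -/
noncomputable def retract (M : Model d m) (θ : EuclideanSpace ℝ (Fin d)) :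
    EuclideanSpace ℝ (Fin d) := if θ ∈ M.Θ then θ else M.nonempty_Θ.some

lemma retract_of_mem {θ : EuclideanSpace ℝ (Fin d)} (hθ : θ ∈ M.Θ) : M.retract θ = θ := if_pos hθ

lemma retract_mem (θ : EuclideanSpace ℝ (Fin d)) : M.retract θ ∈ M.Θ := by
  unfold retract
  split_ifs with h
  exacts [h, M.nonempty_Θ.some_mem]

lemma measurable_retract : Measurable M.retract :=
  Measurable.ite M.isCompact_Θ.isClosed.measurableSet measurable_id measurable_const

/-- The law of the input `X(θ)` as a kernel.  The retraction onto `Θ` makes it a Markov kernel on the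
whole parameter space. -/
noncomputable def inputKernel (M : Model d m) :
    Kernel (EuclideanSpace ℝ (Fin d)) (EuclideanSpace ℝ (Fin m)) :=
  Kernel.withDensity (Kernel.const _ (volume.restrict M.𝒳))
    fun θ x => ENNReal.ofReal (M.fX x (M.retract θ))

lemma inputKernel_apply (θ : EuclideanSpace ℝ (Fin d)) : M.inputKernel θ =
    (volume.restrict M.𝒳).withDensity fun x => ENNReal.ofReal (M.fX x (M.retract θ)) := by
  rw [inputKernel, Kernel.withDensity_apply, Kernel.const_apply]
  exact ENNReal.measurable_ofReal.comp (M.measurable_fX.comp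
    (measurable_snd.prodMk (measurable_retract.comp measurable_fst)))

lemma integral_inputKernel {θ : EuclideanSpace ℝ (Fin d)} (hθ : θ ∈ M.Θ)
    (g : EuclideanSpace ℝ (Fin m) → ℝ) :
    ∫ x, g x ∂M.inputKernel θ = ∫ x in M.𝒳, M.fX x θ * g x := by
  rw [inputKernel_apply, retract_of_mem hθ, integral_withDensity_eq_integral_toReal_smul
    (M.measurable_fX_left θ).ennreal_ofReal
    (Eventually.of_forall fun _ => ENNReal.ofReal_lt_top)]
  refine setIntegral_congr_fun M.measurableSet_𝒳 fun x hx => ?_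
  simp only [smul_eq_mul]
  rw [ENNReal.toReal_ofReal (M.fX_pos x hx θ (M.subset_U hθ)).le]

instance : IsMarkovKernel M.inputKernel := ⟨fun θ => ⟨by
  have hθ := M.subset_U (M.retract_mem θ)
  rw [inputKernel_apply, withDensity_apply _ MeasurableSet.univ, Measure.restrict_univ,
    ← ofReal_integral_eq_lintegral_ofReal (M.integrableOn_fX hθ)
      (M.fX_nonneg_ae hθ Subset.rfl M.measurableSet_𝒳), M.fX_integral _ hθ, ENNReal.ofReal_one]⟩⟩

lemma inputKernel_real {θ : EuclideanSpace ℝ (Fin d)} (hθ : θ ∈ M.Θ)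
    {A : Set (EuclideanSpace ℝ (Fin m))} (hA : MeasurableSet A) :
    (M.inputKernel θ).real A = ∫ x in M.𝒳 ∩ A, M.fX x θ := by
  rw [← integral_indicator_one hA, integral_inputKernel hθ, ← setIntegral_indicator hA]
  refine integral_congr_ae (Eventually.of_forall fun x => ?_)
  by_cases hx : x ∈ A <;> simp [hx]

end Model

/-! ### Tracking of the quantiles -/

section Tracking

variable {d m : ℕ} {M : Model d m} {γ n q : ℕ → ℝ} {θ : ℕ → EuclideanSpace ℝ (Fin d)} {z : ℝ}

/-- A quantile recursion is bounded whatever the parameters `θ k ∈ Θ` do, because the quantiles of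
level `z` stay in a bounded interval. -/
lemma exists_abs_le_of_quantile_recursion (hM : M.SmoothQuantiles) (hz : z ∈ Ioo (0 : ℝ) 1)
    (hpos : ∀ k, 0 < γ k) (hsum : Tendsto (clock γ) atTop atTop) (hγ : Tendsto γ atTop (𝓝 0))
    (hθ : ∀ k, θ k ∈ M.Θ)
    (hn : ∃ l, Tendsto (fun k => ∑ j ∈ Finset.range k, n j) atTop (𝓝 l))
    (hstep : ∀ k, q (k + 1) = q k + γ k * (z - M.cdf (q k) (θ k)) + n k) :
    ∃ K : ℝ, ∀ k, |q k| ≤ K := by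
  obtain ⟨R, hR⟩ := hM.exists_abs_quantile_le hz
  have hn' : ∃ l, Tendsto (fun k => ∑ j ∈ Finset.range k, -n j) atTop (𝓝 l) := by
    obtain ⟨l, hl⟩ := hn
    exact ⟨-l, by simpa only [Finset.sum_neg_distrib] using hl.neg⟩
  have hup : ∀ᶠ k in atTop, q k - R ≤ 1 := by
    refine eventually_le_of_drift (b := fun k => z - M.cdf (q k) (θ k)) (B := 1) hpos hsum hγ
      (Eventually.of_forall fun k => ?_) hn (fun k => by rw [hstep]; ring) (fun δ hδ => ?_) one_pos
    · linarith [hz.2, M.cdf_nonneg (M.subset_U (hθ k)) (q k)]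
    · obtain ⟨η, hη, hgap⟩ := hM.exists_cdf_gap hz hδ
      refine ⟨η, hη, Eventually.of_forall fun k hk => ?_⟩
      linarith [(hgap _ (hθ k) (q k)).1 (by linarith [(abs_le.1 (hR _ (hθ k))).2])]
  have hdown : ∀ᶠ k in atTop, -q k - R ≤ 1 := by
    refine eventually_le_of_drift (b := fun k => M.cdf (q k) (θ k) - z) (B := 1) hpos hsum hγ
      (Eventually.of_forall fun k => ?_) hn' (fun k => by rw [hstep]; ring) (fun δ hδ => ?_) one_pos
    · linarith [hz.1, M.cdf_le_one (M.subset_U (hθ k)) (q k)]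
    · obtain ⟨η, hη, hgap⟩ := hM.exists_cdf_gap hz hδ
      refine ⟨η, hη, Eventually.of_forall fun k hk => ?_⟩
      linarith [(hgap _ (hθ k) (q k)).2 (by linarith [(abs_le.1 (hR _ (hθ k))).1])]
  have hbdd : IsBoundedUnder (· ≤ ·) atTop fun k => |q k| :=
    ⟨R + 1, eventually_map.2 (by
      filter_upwards [hup, hdown] with k h1 h2
      exact abs_le.2 ⟨by linarith, by linarith⟩)⟩
  obtain ⟨K, hK⟩ := hbdd.bddAbove_range
  exact ⟨K, fun k => hK (mem_range_self k)⟩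

/-- If `θ` moves on a slower time scale, the quantile recursion tracks the current quantile: the drift
of the tracking error caused by the motion of `θ` is negligible. -/
lemma tendsto_sub_quantile (hM : M.SmoothQuantiles) (hz : z ∈ Ioo (0 : ℝ) 1)
    (hpos : ∀ k, 0 < γ k) (hsum : Tendsto (clock γ) atTop atTop) (hγ : Tendsto γ atTop (𝓝 0))
    (hθ : ∀ k, θ k ∈ M.Θ)
    (hn : ∃ l, Tendsto (fun k => ∑ j ∈ Finset.range k, n j) atTop (𝓝 l))
    (hstep : ∀ k, q (k + 1) = q k + γ k * (z - M.cdf (q k) (θ k)) + n k)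
    (hslow : (fun k => dist (θ k) (θ (k + 1))) =o[atTop] γ) :
    Tendsto (fun k => q k - M.quantile z (θ k)) atTop (𝓝 0) := by
  obtain ⟨K, hK⟩ := hM.exists_lipschitz_quantile hz
  set Δ : ℕ → ℝ := fun k => (M.quantile z (θ (k + 1)) - M.quantile z (θ k)) / γ k
  have hΔ : Tendsto Δ atTop (𝓝 0) := by
    have h1 : (fun k => M.quantile z (θ (k + 1)) - M.quantile z (θ k)) =O[atTop]
        fun k => dist (θ k) (θ (k + 1)) :=
      IsBigO.of_bound K (Eventually.of_forall fun k => by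
        rw [Real.norm_eq_abs, Real.norm_of_nonneg dist_nonneg]
        exact hK _ (hθ k) _ (hθ (k + 1)))
    exact (h1.trans_isLittleO hslow).tendsto_div_nhds_zero
  have hγΔ : ∀ k, γ k * Δ k = M.quantile z (θ (k + 1)) - M.quantile z (θ k) := fun k =>
    mul_div_cancel₀ _ (hpos k).ne'
  have hn' : ∃ l, Tendsto (fun k => ∑ j ∈ Finset.range k, -n j) atTop (𝓝 l) := by
    obtain ⟨l, hl⟩ := hn
    exact ⟨-l, by simpa only [Finset.sum_neg_distrib] using hl.neg⟩
  have hsmall : ∀ c > 0, ∀ᶠ k in atTop, |Δ k| < c := fun c hc => by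
    simpa [Real.dist_eq] using Metric.tendsto_nhds.1 hΔ c hc
  rw [Metric.tendsto_nhds]
  intro ε hε
  have hup : ∀ᶠ k in atTop, q k - M.quantile z (θ k) ≤ ε / 2 := by
    refine eventually_le_of_drift (b := fun k => z - M.cdf (q k) (θ k) - Δ k) (B := 2) hpos hsum hγ
      ?_ hn (fun k => by rw [hstep]; linear_combination hγΔ k) (fun δ hδ => ?_) (half_pos hε)
    · filter_upwards [hsmall 1 one_pos] with k hk
      linarith [hz.2, M.cdf_nonneg (M.subset_U (hθ k)) (q k), (abs_lt.1 hk).1]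
    · obtain ⟨η, hη, hgap⟩ := hM.exists_cdf_gap hz hδ
      refine ⟨η / 2, half_pos hη, ?_⟩
      filter_upwards [hsmall _ (half_pos hη)] with k hk hek
      linarith [(hgap _ (hθ k) (q k)).1 (by linarith), (abs_lt.1 hk).1]
  have hdown : ∀ᶠ k in atTop, M.quantile z (θ k) - q k ≤ ε / 2 := by
    refine eventually_le_of_drift (b := fun k => M.cdf (q k) (θ k) - z + Δ k) (B := 2) hpos hsum hγ
      ?_ hn' (fun k => by rw [hstep]; linear_combination -hγΔ k) (fun δ hδ => ?_) (half_pos hε)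
    · filter_upwards [hsmall 1 one_pos] with k hk
      linarith [hz.1, M.cdf_le_one (M.subset_U (hθ k)) (q k), (abs_lt.1 hk).2]
    · obtain ⟨η, hη, hgap⟩ := hM.exists_cdf_gap hz hδ
      refine ⟨η / 2, half_pos hη, ?_⟩
      filter_upwards [hsmall _ (half_pos hη)] with k hk hek
      linarith [(hgap _ (hθ k) (q k)).2 (by linarith), (abs_lt.1 hk).2]
  filter_upwards [hup, hdown] with k h1 h2
  rw [Real.dist_eq, sub_zero]
  exact (abs_le.2 ⟨by linarith, h1⟩).trans_lt (half_lt_self hε)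

end Tracking

/-! ### The search direction and its mean -/

/-- Continuous functions on a compact set preserve asymptotic coincidence of sequences. -/
lemma tendsto_sub_of_continuousOn {α E : Type*} [PseudoMetricSpace α] [SeminormedAddCommGroup E]
    {s : Set α} (hs : IsCompact s) {f : α → E} (hf : ContinuousOn f s) {u v : ℕ → α}
    (hu : ∀ k, u k ∈ s) (hv : ∀ k, v k ∈ s) (huv : Tendsto (fun k => dist (u k) (v k)) atTop (𝓝 0)) :
    Tendsto (fun k => f (u k) - f (v k)) atTop (𝓝 0) := by
  rw [Metric.tendsto_nhds]
  intro ε hε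
  obtain ⟨δ, hδ, h⟩ :=
    Metric.uniformContinuousOn_iff.1 (hs.uniformContinuousOn_of_continuous hf) ε hε
  filter_upwards [huv.eventually_lt_const hδ] with k hk
  rw [dist_zero_right, ← dist_eq_norm]
  exact h _ (hu k) _ (hv k) hk

/-- A projected step from a point of a convex set: squared distances to points `v` of the set are
bounded by those of the unprojected step. -/
lemma IsProjection.norm_sub_sq_le {d : ℕ} {S : Set (EuclideanSpace ℝ (Fin d))} (hS : Convex ℝ S)
    {u y v : EuclideanSpace ℝ (Fin d)} (h : IsProjection S u y) (hv : v ∈ S) :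
    ‖y - v‖ ^ 2 ≤ ‖u - v‖ ^ 2 := by
  have hinf : ‖u - y‖ = ⨅ w : S, ‖u - w‖ := by
    have : Nonempty S := ⟨⟨y, h.1⟩⟩
    refine le_antisymm (le_ciInf fun w => h.2 w w.2) (ciInf_le ⟨0, ?_⟩ (⟨y, h.1⟩ : S))
    rintro _ ⟨w, rfl⟩
    exact norm_nonneg _
  have hin := (norm_eq_iInf_iff_real_inner_le_zero hS h.1).1 hinf v hv
  have e1 : ⟪u - y, v - y⟫ = -⟪u - y, y - v⟫ := by rw [← inner_neg_right, neg_sub]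
  have e2 : ‖u - v‖ ^ 2 = ‖u - y‖ ^ 2 + 2 * ⟪u - y, y - v⟫ + ‖y - v‖ ^ 2 := by
    rw [← norm_add_sq_real, sub_add_sub_cancel]
  nlinarith [sq_nonneg ‖u - y‖]

lemma IsProjection.dist_le {d : ℕ} {S : Set (EuclideanSpace ℝ (Fin d))}
    {a g y : EuclideanSpace ℝ (Fin d)} (h : IsProjection S (a + g) y) (ha : a ∈ S) :
    dist a y ≤ 2 * ‖g‖ := by
  have h1 := h.2 a ha
  rw [add_sub_cancel_left] at h1
  calc dist a y = ‖(a + g - y) - g‖ := by rw [dist_eq_norm]; congr 1; abel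
    _ ≤ ‖a + g - y‖ + ‖g‖ := norm_sub_le _ _
    _ ≤ 2 * ‖g‖ := by linarith

namespace Model

variable {d m N : ℕ} (M : Model d m) (w : ℝ → ℝ) (z : Fin (N + 1) → ℝ)

/-- The random search direction `∑ᵢ (-G₁(x; θ, qᵢ)) w̃'(zᵢ) (qᵢ - qᵢ₋₁)` of the recursion for `θ`. -/
noncomputable def searchDirection (x : EuclideanSpace ℝ (Fin m)) (θ : EuclideanSpace ℝ (Fin d))
    (q : Fin (N + 1) → ℝ) : EuclideanSpace ℝ (Fin d) :=
  ∑ i : Fin N, (deriv (fun s => w (1 - s)) (z i.succ) * (q i.succ - q i.castSucc)) •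
    (-M.G₁ x θ (q i.succ))

/-- The mean search direction `∑ᵢ ∇_θ F(qᵢ; θ) w̃'(zᵢ) (qᵢ - qᵢ₋₁)` at fixed quantile estimates `q`;
at the true quantiles it is `∇_θ J^q_N(θ)`. -/
noncomputable def meanDirection (q : Fin (N + 1) → ℝ) (θ : EuclideanSpace ℝ (Fin d)) :
    EuclideanSpace ℝ (Fin d) :=
  ∑ i : Fin N, (deriv (fun s => w (1 - s)) (z i.succ) * (q i.succ - q i.castSucc)) •
    M.gradCdf (q i.succ) θ

/-- A uniform bound for the search directions when the quantile estimates are bounded by `K` and the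
scores by `C`. -/
noncomputable def directionBound (K C : ℝ) : ℝ :=
  ∑ i : Fin N, |deriv (fun s => w (1 - s)) (z i.succ)| * (2 * K) * C

/-- The component of the search direction in the direction of `v ∈ Θ`, set to zero when some quantile
estimate exceeds `K` in absolute value. -/
noncomputable def truncatedComponent (K : ℝ) (v : EuclideanSpace ℝ (Fin d))
    (p : (EuclideanSpace ℝ (Fin d) × (Fin (N + 1) → ℝ)) × EuclideanSpace ℝ (Fin m)) : ℝ :=
  {q : Fin (N + 1) → ℝ | ∀ i, |q i| ≤ K}.indicator (fun q => ∑ i : Fin N,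
    deriv (fun s => w (1 - s)) (z i.succ) * (q i.succ - q i.castSucc) *
      ((if M.𝓛 p.2 ≤ q i.succ then 1 else 0) * M.scoreToward v (p.1.1, p.2))) p.1.2

variable {M w z}

lemma measurableSet_forall_abs_le (K : ℝ) :
    MeasurableSet {q : Fin (N + 1) → ℝ | ∀ i, |q i| ≤ K} :=
  (isClosed_le (f := fun q : Fin (N + 1) → ℝ => fun i => |q i|) (g := fun _ _ => K)
    (by fun_prop) (by fun_prop)).measurableSet

lemma measurable_truncatedComponent (K : ℝ) (v : EuclideanSpace ℝ (Fin d)) :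
    Measurable (M.truncatedComponent w z K v) := by
  have hset : MeasurableSet {p : (EuclideanSpace ℝ (Fin d) × (Fin (N + 1) → ℝ)) ×
      EuclideanSpace ℝ (Fin m) | ∀ i, |p.1.2 i| ≤ K} :=
    (measurable_snd.comp measurable_fst) (measurableSet_forall_abs_le K)
  refine Measurable.indicator (f := fun p : (EuclideanSpace ℝ (Fin d) × (Fin (N + 1) → ℝ)) ×
      EuclideanSpace ℝ (Fin m) => ∑ i : Fin N,
    deriv (fun s => w (1 - s)) (z i.succ) * (p.1.2 i.succ - p.1.2 i.castSucc) *
      ((if M.𝓛 p.2 ≤ p.1.2 i.succ then 1 else 0) * M.scoreToward v (p.1.1, p.2)))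
    (Finset.measurable_sum _ fun i _ => ?_) hset
  refine Measurable.mul (by fun_prop) (Measurable.mul (Measurable.ite ?_ measurable_const
    measurable_const) ((measurable_scoreToward (M := M)).comp (by fun_prop)))
  exact measurableSet_le (M.measurable_𝓛.comp measurable_snd) (by fun_prop)

lemma abs_truncatedComponent_le {C : ℝ} (hC0 : 0 ≤ C)
    (hC : ∀ x ∈ M.𝒳, ∀ θ ∈ M.Θ, ‖M.score x θ‖ ≤ C) {K : ℝ} (hK : 0 ≤ K)
    {v : EuclideanSpace ℝ (Fin d)} (hv : v ∈ M.Θ)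
    (p : (EuclideanSpace ℝ (Fin d) × (Fin (N + 1) → ℝ)) × EuclideanSpace ℝ (Fin m)) :
    |M.truncatedComponent w z K v p| ≤ directionBound w z K (C * Metric.diam M.Θ) := by
  have hD : 0 ≤ C * Metric.diam M.Θ := mul_nonneg hC0 Metric.diam_nonneg
  by_cases hp : p.1.2 ∈ {q : Fin (N + 1) → ℝ | ∀ i, |q i| ≤ K}
  · rw [truncatedComponent, indicator_of_mem hp]
    refine (Finset.abs_sum_le_sum_abs _ _).trans (Finset.sum_le_sum fun i _ => ?_)
    rw [abs_mul, abs_mul, abs_mul]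
    have h1 : |p.1.2 i.succ - p.1.2 i.castSucc| ≤ 2 * K :=
      (abs_sub _ _).trans (by linarith [hp i.succ, hp i.castSucc])
    have h2 : |(if M.𝓛 p.2 ≤ p.1.2 i.succ then (1 : ℝ) else 0)| ≤ 1 := by split_ifs <;> simp
    have h3 := abs_scoreToward_le hC0 hC hv (p.1.1, p.2)
    have h4 : |(if M.𝓛 p.2 ≤ p.1.2 i.succ then (1 : ℝ) else 0)| * |M.scoreToward v (p.1.1, p.2)|
        ≤ C * Metric.diam M.Θ :=
      (mul_le_of_le_one_left (abs_nonneg _) h2).trans h3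
    gcongr
  · rw [truncatedComponent, indicator_of_notMem hp, abs_zero]
    exact Finset.sum_nonneg fun i _ => by positivity

lemma norm_searchDirection_le {C : ℝ}
    (hC : ∀ x ∈ M.𝒳, ∀ θ ∈ M.Θ, ‖M.score x θ‖ ≤ C) {K : ℝ} {q : Fin (N + 1) → ℝ}
    (hq : ∀ i, |q i| ≤ K) {x : EuclideanSpace ℝ (Fin m)} (hx : x ∈ M.𝒳)
    {θ : EuclideanSpace ℝ (Fin d)} (hθ : θ ∈ M.Θ) :
    ‖M.searchDirection w z x θ q‖ ≤ directionBound w z K C := by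
  have hK : 0 ≤ K := (abs_nonneg _).trans (hq 0)
  refine (norm_sum_le _ _).trans (Finset.sum_le_sum fun i _ => ?_)
  rw [norm_smul, norm_mul, G₁, neg_neg, norm_smul, Real.norm_eq_abs, Real.norm_eq_abs,
    Real.norm_eq_abs]
  have h1 : |q i.succ - q i.castSucc| ≤ 2 * K :=
    (abs_sub _ _).trans (by linarith [hq i.succ, hq i.castSucc])
  have h2 : |(if M.𝓛 x ≤ q i.succ then (1 : ℝ) else 0)| ≤ 1 := by split_ifs <;> simp
  have h4 : |(if M.𝓛 x ≤ q i.succ then (1 : ℝ) else 0)| * ‖M.score x θ‖ ≤ C :=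
    (mul_le_of_le_one_left (norm_nonneg _) h2).trans (hC x hx θ hθ)
  gcongr

lemma truncatedComponent_eq {K : ℝ} {q : Fin (N + 1) → ℝ} (hq : ∀ i, |q i| ≤ K)
    {x : EuclideanSpace ℝ (Fin m)} (hx : x ∈ M.𝒳) {θ : EuclideanSpace ℝ (Fin d)} (hθ : θ ∈ M.Θ)
    (v : EuclideanSpace ℝ (Fin d)) :
    M.truncatedComponent w z K v ((θ, q), x) = ⟪M.searchDirection w z x θ q, v - θ⟫ := by
  rw [truncatedComponent, indicator_of_mem (by exact hq), searchDirection, sum_inner]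
  refine Finset.sum_congr rfl fun i _ => ?_
  rw [real_inner_smul_left, G₁, neg_neg, real_inner_smul_left, scoreToward,
    indicator_of_mem (show (θ, x) ∈ M.Θ ×ˢ M.𝒳 from ⟨hθ, hx⟩)]

lemma integral_truncatedComponent (hM : M.SmoothQuantiles) (hscore : M.BoundedScore) {K : ℝ}
    {q : Fin (N + 1) → ℝ} (hq : ∀ i, |q i| ≤ K) {θ v : EuclideanSpace ℝ (Fin d)} (hθ : θ ∈ M.Θ)
    (hv : v ∈ M.Θ) :
    ∫ x, M.truncatedComponent w z K v ((θ, q), x) ∂M.inputKernel θ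
      = ⟪M.meanDirection w z q θ, v - θ⟫ := by
  obtain ⟨C, hC0, hC⟩ := id hscore
  have hbase : ∀ y, Measurable fun x : EuclideanSpace ℝ (Fin m) =>
      (if M.𝓛 x ≤ y then (1 : ℝ) else 0) * M.scoreToward v (θ, x) := fun y =>
    (Measurable.ite (M.measurableSet_sublevel y) measurable_const measurable_const).mul
      ((measurable_scoreToward (M := M)).comp (by fun_prop))
  have hint : ∀ y, Integrable (fun x : EuclideanSpace ℝ (Fin m) =>
      (if M.𝓛 x ≤ y then (1 : ℝ) else 0) * M.scoreToward v (θ, x)) (M.inputKernel θ) := fun y =>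
    Integrable.of_bound (hbase y).aestronglyMeasurable (C * Metric.diam M.Θ)
      (Eventually.of_forall fun x => by
        rw [norm_mul]
        exact (mul_le_of_le_one_left (norm_nonneg _) (by split_ifs <;> simp)).trans
          (abs_scoreToward_le hC0.le hC hv (θ, x)))
  simp only [truncatedComponent, indicator_of_mem (show q ∈ {q : Fin (N + 1) → ℝ |
    ∀ i, |q i| ≤ K} from hq)]
  rw [integral_finsetSum _ fun i _ => (hint _).const_mul _, meanDirection, sum_inner]
  refine Finset.sum_congr rfl fun i _ => ?_
  rw [integral_const_mul, real_inner_smul_left, integral_inputKernel hθ,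
    ← setIntegral_fX_mul_scoreToward hM hscore hθ hv,
    ← setIntegral_indicator (M.measurableSet_sublevel _)]
  congr 1
  refine integral_congr_ae (Eventually.of_forall fun x => ?_)
  by_cases hx : M.𝓛 x ≤ q i.succ
  · simp [hx]
  · simp [hx]

lemma tendsto_meanDirection_sub_gradJ (hM : M.SmoothQuantiles) (hz : IsGrid z)
    {θ : ℕ → EuclideanSpace ℝ (Fin d)} (hθ : ∀ k, θ k ∈ M.Θ) {q : ℕ → Fin (N + 1) → ℝ} {K : ℝ}
    (hq : ∀ k i, |q k i| ≤ K)
    (htrack : ∀ i, Tendsto (fun k => q k i - M.quantile (z i) (θ k)) atTop (𝓝 0)) :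
    Tendsto (fun k => M.meanDirection w z (q k) (θ k) - M.gradJ w z (θ k)) atTop (𝓝 0) := by
  choose R hR using fun i => hM.exists_abs_quantile_le (hz.mem_Ioo i)
  simp only [meanDirection, gradJ, ← Finset.sum_sub_distrib]
  rw [← Finset.sum_const_zero (s := (Finset.univ : Finset (Fin N)))]
  refine tendsto_finsetSum _ fun i _ => ?_
  set c := deriv (fun s => w (1 - s)) (z i.succ)
  set B := max K (max (R i.succ) (R i.castSucc))
  have hKB : K ≤ B := le_max_left _ _
  have hB1 : R i.succ ≤ B := (le_max_left _ _).trans (le_max_right _ _)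
  have hB2 : R i.castSucc ≤ B := (le_max_right _ _).trans (le_max_right _ _)
  have hmem : ∀ {t : ℝ}, |t| ≤ B → t ∈ Icc (-B) B := fun h => abs_le.1 h
  refine tendsto_sub_of_continuousOn
    (f := fun p : ℝ × ℝ × EuclideanSpace ℝ (Fin d) => (c * (p.1 - p.2.1)) • M.gradCdf p.1 p.2.2)
    (s := Icc (-B) B ×ˢ Icc (-B) B ×ˢ M.Θ)
    (u := fun k => (q k i.succ, q k i.castSucc, θ k))
    (v := fun k => (M.quantile (z i.succ) (θ k), M.quantile (z i.castSucc) (θ k), θ k))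
    (isCompact_Icc.prod (isCompact_Icc.prod M.isCompact_Θ)) ?_
    (fun k => ⟨hmem ((hq _ _).trans hKB), hmem ((hq _ _).trans hKB), hθ k⟩)
    (fun k => ⟨hmem ((hR _ _ (hθ k)).trans hB1), hmem ((hR _ _ (hθ k)).trans hB2), hθ k⟩) ?_
  · refine ContinuousOn.fun_smul (by fun_prop) ?_
    exact hM.gradCdf_continuous.comp
      (f := fun p : ℝ × ℝ × EuclideanSpace ℝ (Fin d) => (p.1, p.2.2)) (by fun_prop)
      fun p hp => ⟨mem_univ _, hp.2.2⟩
  · have h := (htrack i.succ).abs.max (htrack i.castSucc).abs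
    simp only [abs_zero, max_self] at h
    refine h.congr fun k => ?_
    simp [Prod.dist_eq, Real.dist_eq]

end Model

lemma IsStepSize.tendsto_zero {γ : ℕ → ℝ} (h : IsStepSize γ) : Tendsto γ atTop (𝓝 0) := by
  have := h.sum_sq.tendsto_atTop_zero.sqrt
  simpa [Real.sqrt_sq (h.pos _).le] using this

/-! ### The history of the iterates and conditional means -/

section History

variable {d N : ℕ} {Ω : Type*} {q : ℕ → Ω → Fin (N + 1) → ℝ}
  {θ : ℕ → Ω → EuclideanSpace ℝ (Fin d)}

lemma history_mono : Monotone (history θ q) := fun _ _ hkl =>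
  biSup_mono fun _ hj => Finset.range_mono (Nat.succ_le_succ hkl) hj

lemma measurable_iterate {j k : ℕ} (hjk : j ≤ k) :
    Measurable[history θ q k] fun ω => (θ j ω, q j ω) :=
  (comap_measurable (fun ω => (θ j ω, q j ω))).mono
    (le_iSup₂_of_le j (Finset.mem_range.2 (Nat.lt_succ_of_le hjk)) le_rfl) le_rfl

end History

namespace IsQFRecursion

variable {d m N : ℕ} {M : Model d m} {w : ℝ → ℝ} {z : Fin (N + 1) → ℝ} {γq γθ : ℕ → ℝ}
  {Ω : Type*} [mΩ : MeasurableSpace Ω] {μ : Measure Ω} {X : ℕ → Ω → EuclideanSpace ℝ (Fin m)}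
  {q : ℕ → Ω → Fin (N + 1) → ℝ} {θ : ℕ → Ω → EuclideanSpace ℝ (Fin d)}

lemma mem (H : IsQFRecursion M w z γq γθ μ X q θ) (k : ℕ) (ω : Ω) : θ k ω ∈ M.Θ := by
  cases k with
  | zero => exact H.init_mem ω
  | succ k => exact (H.step_θ k ω).1

lemma history_le (H : IsQFRecursion M w z γq γθ μ X q θ) (k : ℕ) : history θ q k ≤ mΩ :=
  iSup₂_le fun j _ => ((H.measurable_θ j).prodMk (H.measurable_q j)).comap_le

/-- The filtration generated by the iterates. -/
def filtration (H : IsQFRecursion M w z γq γθ μ X q θ) : Filtration ℕ mΩ where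
  seq := history θ q
  mono' := history_mono
  le' := H.history_le

open ProbabilityTheory in
lemma condExp_eq [IsProbabilityMeasure μ] (H : IsQFRecursion M w z γq γθ μ X q θ) (k : ℕ)
    {φ : (EuclideanSpace ℝ (Fin d) × (Fin (N + 1) → ℝ)) × EuclideanSpace ℝ (Fin m) → ℝ}
    (hφ : Measurable φ) {B : ℝ} (hB : ∀ p, |φ p| ≤ B) :
    μ[fun ω => φ ((θ k ω, q k ω), X k ω) | history θ q k]
      =ᵐ[μ] fun ω => ∫ x, φ ((θ k ω, q k ω), x) ∂M.inputKernel (θ k ω) := by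
  refine condExp_comp_eq_integral_kernel (H.history_le k) (H.measurable_X k)
    (measurable_iterate le_rfl) (M.inputKernel.comap Prod.fst measurable_fst)
    (fun A hA => ?_) hφ hB
  filter_upwards [H.sample k A hA] with ω hω
  rw [hω, Kernel.comap_apply, Model.inputKernel_real (H.mem k ω) hA]

lemma ae_X_mem [IsProbabilityMeasure μ] (H : IsQFRecursion M w z γq γθ μ X q θ) :
    ∀ᵐ ω ∂μ, ∀ k, X k ω ∈ M.𝒳 := by
  refine ae_all_iff.2 fun k => ?_
  have hA := M.measurableSet_𝒳.compl
  have hint : ∫ ω, (X k ⁻¹' M.𝒳ᶜ).indicator (fun _ => (1 : ℝ)) ω ∂μ = 0 := by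
    rw [← integral_condExp (H.history_le k)]
    refine integral_eq_zero_of_ae ?_
    filter_upwards [H.sample k _ hA] with ω hω
    rw [hω]
    simp
  rw [integral_indicator (H.measurable_X k hA)] at hint
  simp only [integral_const, smul_eq_mul, mul_one, measureReal_restrict_apply MeasurableSet.univ,
    univ_inter, measureReal_eq_zero_iff (measure_ne_top _ _)] at hint
  exact hint

/-! ### The noise of the two recursions -/

/-- The noise of the quantile recursion sums up.  The indicator of `{Y_k ≤ q_k}` is part of the
history of step `k + 1`, since it can be read off the increment of `q`. -/
lemma ae_quantile_recursion [IsProbabilityMeasure μ] (hγq : IsStepSize γq)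
    (H : IsQFRecursion M w z γq γθ μ X q θ) :
    ∀ᵐ ω ∂μ, ∀ i, ∃ n : ℕ → ℝ, (∃ l, Tendsto (fun k => ∑ j ∈ Finset.range k, n j) atTop (𝓝 l)) ∧
      ∀ k, q (k + 1) ω i = q k ω i + γq k * (z i - M.cdf (q k ω i) (θ k ω)) + n k := by
  refine ae_all_iff.2 fun i => ?_
  set S : ℕ → Ω → ℝ := fun k ω => -γq k * (if M.𝓛 (X k ω) ≤ q k ω i then 1 else 0)
  have hSq : ∀ k ω, S k ω = q (k + 1) ω i - q k ω i - γq k * z i := fun k ω => by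
    rw [H.step_q]; ring
  have hSmeas : ∀ k, StronglyMeasurable[H.filtration (k + 1)] (S k) := fun k => by
    have h1 : Measurable[history θ q (k + 1)] fun ω => (θ (k + 1) ω, q (k + 1) ω) :=
      measurable_iterate le_rfl
    have h2 : Measurable[history θ q (k + 1)] fun ω => (θ k ω, q k ω) :=
      measurable_iterate k.le_succ
    have hp : Measurable fun p : EuclideanSpace ℝ (Fin d) × (Fin (N + 1) → ℝ) => p.2 i := by
      fun_prop
    rw [funext (hSq k)]
    exact (((hp.comp h1).sub (hp.comp h2)).sub measurable_const).stronglyMeasurable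
  have hSbdd : ∀ k ω, |S k ω| ≤ γq k := fun k ω => by
    have := (hγq.pos k).le
    simp only [S, abs_mul, abs_neg, abs_of_nonneg this]
    exact mul_le_of_le_one_right this (by split_ifs <;> simp)
  have hcond : ∀ k, μ[S k | history θ q k] =ᵐ[μ] fun ω => -γq k * M.cdf (q k ω i) (θ k ω) := by
    intro k
    have h := H.condExp_eq k (φ := fun p => -γq k * (if M.𝓛 p.2 ≤ p.1.2 i then 1 else 0))
      (B := γq k) (measurable_const.mul (Measurable.ite
        (measurableSet_le (M.measurable_𝓛.comp measurable_snd) (by fun_prop))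
        measurable_const measurable_const)) (fun p => by
          have := (hγq.pos k).le
          rw [abs_mul, abs_neg, abs_of_nonneg this]
          exact mul_le_of_le_one_right this (by split_ifs <;> simp))
    filter_upwards [h] with ω hω
    rw [hω, integral_const_mul, Model.integral_inputKernel (H.mem k ω), Model.cdf,
      ← setIntegral_indicator (M.measurableSet_sublevel _)]
    congr 2
    funext x
    by_cases hx : M.𝓛 x ≤ q k ω i <;> simp [hx]
  filter_upwards [ae_tendsto_sum_sub_condExp H.filtration hSmeas
    (fun k => Eventually.of_forall (hSbdd k)) hγq.sum_sq, ae_all_iff.2 hcond] with ω hω hc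
  refine ⟨_, hω, fun k => ?_⟩
  have hk : (μ[S k | H.filtration k]) ω = -γq k * M.cdf (q k ω i) (θ k ω) := hc k
  rw [hk, hSq]
  ring

/-- The variational inequality for the squared distance from `θ_k` to a point `v ∈ Θ`, up to
martingale noise.  The martingale difference is the centered increment of the squared distance itself
rather than the centered search direction: where the projection is active, the latter is not
determined by the history of the iterates.  The truncation at `K` provides integrability. -/
lemma ae_variational [IsProbabilityMeasure μ] (hM : M.SmoothQuantiles)
    (hscore : M.BoundedScore) (hγθ : IsStepSize γθ) (H : IsQFRecursion M w z γq γθ μ X q θ)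
    {v : EuclideanSpace ℝ (Fin d)} (hv : v ∈ M.Θ) {K : ℝ} (hK : 0 ≤ K) :
    ∀ᵐ ω ∂μ, (∀ k i, |q k ω i| ≤ K) → ∃ (G : ℝ) (n : ℕ → ℝ),
      (∃ l, Tendsto (fun k => ∑ j ∈ Finset.range k, n j) atTop (𝓝 l)) ∧
      ∀ k, ‖θ (k + 1) ω - v‖ ^ 2 - ‖θ k ω - v‖ ^ 2
        ≤ γθ k * (2 * ⟪M.meanDirection w z (q k ω) (θ k ω), θ k ω - v⟫ + γθ k * G) + n k := by
  obtain ⟨C, hC0, hC⟩ := id hscore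
  set G := Model.directionBound w z K C
  have hG : 0 ≤ G := Finset.sum_nonneg fun i _ => by positivity
  set QK : Set (Fin (N + 1) → ℝ) := {q | ∀ i, |q i| ≤ K}
  have hQK : MeasurableSet QK := Model.measurableSet_forall_abs_le K
  set S : ℕ → Ω → ℝ := fun k ω =>
    QK.indicator (fun _ => 1) (q k ω) * (‖θ (k + 1) ω - v‖ ^ 2 - ‖θ k ω - v‖ ^ 2)
  have hSmeas : ∀ k, StronglyMeasurable[H.filtration (k + 1)] (S k) := fun k => by
    have h1 : Measurable[history θ q (k + 1)] fun ω => (θ (k + 1) ω, q (k + 1) ω) :=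
      measurable_iterate le_rfl
    have h2 : Measurable[history θ q (k + 1)] fun ω => (θ k ω, q k ω) :=
      measurable_iterate k.le_succ
    have hp : Measurable fun p : EuclideanSpace ℝ (Fin d) × (Fin (N + 1) → ℝ) => ‖p.1 - v‖ ^ 2 := by
      fun_prop
    have hi : Measurable fun p : EuclideanSpace ℝ (Fin d) × (Fin (N + 1) → ℝ) =>
        QK.indicator (fun _ => (1 : ℝ)) p.2 :=
      (measurable_const.indicator hQK).comp measurable_snd
    exact ((hi.comp h2).mul ((hp.comp h1).sub (hp.comp h2))).stronglyMeasurable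
  -- one step of the recursion moves `θ` by `O(γθ k)` as long as `q` stays in `QK`
  have hstep : ∀ k ω, X k ω ∈ M.𝒳 → q k ω ∈ QK → dist (θ k ω) (θ (k + 1) ω) ≤ 2 * (γθ k * G) := by
    intro k ω hX hq
    refine ((H.step_θ k ω).dist_le (H.mem k ω)).trans ?_
    rw [norm_smul, Real.norm_of_nonneg (hγθ.pos k).le]
    have := Model.norm_searchDirection_le (w := w) (z := z) hC hq hX (H.mem k ω)
    have h0 := (hγθ.pos k).le
    gcongr
    exact this
  have hSbdd : ∀ k, ∀ᵐ ω ∂μ, |S k ω| ≤ γθ k * (4 * G * Metric.diam M.Θ) := fun k => by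
    filter_upwards [H.ae_X_mem] with ω hX
    by_cases hq : q k ω ∈ QK
    · simp only [S, indicator_of_mem hq, one_mul]
      have h1 := hstep k ω (hX k) hq
      have h2 : dist (θ k ω) v ≤ Metric.diam M.Θ :=
        Metric.dist_le_diam_of_mem M.isCompact_Θ.isBounded (H.mem k ω) hv
      have h3 : dist (θ (k + 1) ω) v ≤ Metric.diam M.Θ :=
        Metric.dist_le_diam_of_mem M.isCompact_Θ.isBounded (H.mem (k + 1) ω) hv
      rw [← dist_eq_norm, ← dist_eq_norm, sq_sub_sq, abs_mul]
      have h4 : |dist (θ (k + 1) ω) v - dist (θ k ω) v| ≤ 2 * (γθ k * G) :=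
        (abs_dist_sub_le _ _ _).trans (by rwa [dist_comm])
      have h5 : |dist (θ (k + 1) ω) v + dist (θ k ω) v| ≤ 2 * Metric.diam M.Θ := by
        rw [abs_of_nonneg (by positivity)]; linarith
      calc _ ≤ 2 * Metric.diam M.Θ * (2 * (γθ k * G)) :=
            mul_le_mul h5 h4 (abs_nonneg _) (by positivity)
        _ = _ := by ring
    · simp only [S, indicator_of_notMem hq, zero_mul, abs_zero]
      have := (hγθ.pos k).le
      positivity
  have hSint : ∀ k, Integrable (S k) μ := fun k =>
    Integrable.of_bound ((hSmeas k).mono (H.filtration.le _)).aestronglyMeasurable _ (hSbdd k)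
  set T : ℕ → Ω → ℝ := fun k ω => M.truncatedComponent w z K v ((θ k ω, q k ω), X k ω)
  have hTbdd := Model.abs_truncatedComponent_le (w := w) (z := z) hC0.le hC hK hv
  have hTint : ∀ k, Integrable (T k) μ := fun k =>
    Integrable.of_bound ((Model.measurable_truncatedComponent K v).comp
      (((H.measurable_θ k).prodMk (H.measurable_q k)).prodMk
        (H.measurable_X k))).aestronglyMeasurable _ (Eventually.of_forall fun ω => hTbdd _)
  have hSle : ∀ k, S k ≤ᵐ[μ] (-2 * γθ k) • T k + fun _ => γθ k ^ 2 * G ^ 2 := fun k => by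
    filter_upwards [H.ae_X_mem] with ω hX
    simp only [Pi.add_apply, Pi.smul_apply, smul_eq_mul]
    by_cases hq : q k ω ∈ QK
    · simp only [S, T, indicator_of_mem hq, one_mul,
        Model.truncatedComponent_eq hq (hX k) (H.mem k ω)]
      have h1 := (H.step_θ k ω).norm_sub_sq_le M.convex_Θ hv
      change _ ≤ ‖θ k ω + γθ k • M.searchDirection w z (X k ω) (θ k ω) (q k ω) - v‖ ^ 2 at h1
      have h2 := Model.norm_searchDirection_le (w := w) (z := z) hC hq (hX k) (H.mem k ω)
      set g := M.searchDirection w z (X k ω) (θ k ω) (q k ω)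
      have h3 : ‖g‖ ^ 2 ≤ G ^ 2 := by gcongr
      rw [add_sub_right_comm, norm_add_sq_real, real_inner_smul_right, norm_smul, mul_pow,
        Real.norm_eq_abs, sq_abs, real_inner_comm] at h1
      have h4 := mul_le_mul_of_nonneg_left h3 (sq_nonneg (γθ k))
      have h5 : ⟪g, v - θ k ω⟫ = -⟪g, θ k ω - v⟫ := by rw [← inner_neg_right, neg_sub]
      rw [h5]
      linarith
    · have hT : T k ω = 0 := indicator_of_notMem hq _
      simp only [S, hT, indicator_of_notMem hq, zero_mul, mul_zero, zero_add]
      positivity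
  have hcond : ∀ k, ∀ᵐ ω ∂μ, q k ω ∈ QK → (μ[S k | history θ q k]) ω
      ≤ -2 * γθ k * ⟪M.meanDirection w z (q k ω) (θ k ω), v - θ k ω⟫ + γθ k ^ 2 * G ^ 2 := by
    intro k
    have h1 := condExp_mono (m := history θ q k) (hSint k)
      (((hTint k).smul (-2 * γθ k)).add (integrable_const (γθ k ^ 2 * G ^ 2))) (hSle k)
    have h2 := condExp_add ((hTint k).smul (-2 * γθ k)) (integrable_const (γθ k ^ 2 * G ^ 2))
      (history θ q k)
    have h3 := condExp_smul (μ := μ) (-2 * γθ k) (T k) (history θ q k)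
    have h4 := H.condExp_eq k (Model.measurable_truncatedComponent (M := M) (w := w) (z := z) K v)
      hTbdd
    filter_upwards [h1, h2, h3, h4] with ω h1 h2 h3 h4 hq
    have h4' : (μ[T k | history θ q k]) ω = _ := h4
    rw [h2, Pi.add_apply, h3, condExp_const (H.history_le k), Pi.smul_apply, smul_eq_mul, h4',
      Model.integral_truncatedComponent hM hscore hq (H.mem k ω) hv] at h1
    exact h1
  have hsum : Summable fun k => (γθ k * (4 * G * Metric.diam M.Θ)) ^ 2 := by
    simpa only [mul_pow] using hγθ.sum_sq.mul_right _
  filter_upwards [ae_tendsto_sum_sub_condExp H.filtration hSmeas hSbdd hsum,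
    ae_all_iff.2 hcond] with ω hω hc hq
  refine ⟨G ^ 2, _, hω, fun k => ?_⟩
  have h1 := hc k (hq k)
  have h2 : S k ω = ‖θ (k + 1) ω - v‖ ^ 2 - ‖θ k ω - v‖ ^ 2 := by
    simp only [S, indicator_of_mem (show q k ω ∈ QK from hq k), one_mul]
  have h3 : (μ[S k | H.filtration k]) ω = (μ[S k | history θ q k]) ω := rfl
  rw [h3, h2]
  rw [← neg_sub, inner_neg_right] at h1
  linarith

/-! ### The iterates follow the projected ODE -/

/-- Almost every path of `θ` is an approximate trajectory.  The bound on the estimates `q` depends on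
the path, so the truncated inequalities are used for all integer truncation levels at once. -/
lemma ae_isApproxTrajectory [IsProbabilityMeasure μ] (hz : IsGrid z) (hM : M.SmoothQuantiles)
    (hγq : IsStepSize γq) (hγθ : IsStepSize γθ) (hγ : γθ =o[atTop] γq) (hscore : M.BoundedScore)
    (H : IsQFRecursion M w z γq γθ μ X q θ) : ∃ D : Set (EuclideanSpace ℝ (Fin d)),
      ∀ᵐ ω ∂μ, ∃ C, IsApproxTrajectory M.Θ (M.gradJ w z) γθ C D fun k => θ k ω := by
  obtain ⟨C, hC0, hC⟩ := id hscore
  obtain ⟨D, hDΘ, hDc, hD⟩ :=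
    (TopologicalSpace.IsSeparable.of_separableSpace M.Θ).exists_countable_dense_subset
  refine ⟨D, ?_⟩
  have hvar : ∀ᵐ ω ∂μ, ∀ K : ℕ, ∀ v ∈ D, (∀ k i, |q k ω i| ≤ (K : ℝ)) → _ :=
    ae_all_iff.2 fun K => (ae_ball_iff hDc).2 fun v hv =>
      H.ae_variational hM hscore hγθ (hDΘ hv) K.cast_nonneg
  filter_upwards [H.ae_X_mem, H.ae_quantile_recursion hγq, hvar] with ω hX hq hvar
  choose n hn hqstep using hq
  have hmem : ∀ k, θ k ω ∈ M.Θ := fun k => H.mem k ω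
  choose R hR using fun i => exists_abs_le_of_quantile_recursion (q := fun k => q k ω i) hM (hz.mem_Ioo i) hγq.pos
    hγq.sum_eq_top hγq.tendsto_zero hmem (hn i) (hqstep i)
  obtain ⟨K, hK⟩ := exists_nat_ge (∑ i, R i)
  have hqK : ∀ k i, |q k ω i| ≤ (K : ℝ) := fun k i =>
    ((hR i k).trans (Finset.single_le_sum (f := R)
      (fun j _ => (abs_nonneg _).trans (hR j 0)) (Finset.mem_univ i))).trans hK
  set G := Model.directionBound w z K C
  have hG : 0 ≤ G := Finset.sum_nonneg fun i _ => by positivity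
  have hinc : ∀ k, dist (θ k ω) (θ (k + 1) ω) ≤ 2 * G * γθ k := by
    intro k
    refine ((H.step_θ k ω).dist_le (H.mem k ω)).trans ?_
    rw [norm_smul, Real.norm_of_nonneg (hγθ.pos k).le]
    have h1 : ‖M.searchDirection w z (X k ω) (θ k ω) (q k ω)‖ ≤ G :=
      Model.norm_searchDirection_le hC (hqK k) (hX k) (hmem k)
    have h2 := mul_le_mul_of_nonneg_left h1 (hγθ.pos k).le
    calc _ ≤ 2 * (γθ k * G) := mul_le_mul_of_nonneg_left h2 zero_le_two
      _ = _ := by ring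
  have hslow : (fun k => dist (θ k ω) (θ (k + 1) ω)) =o[atTop] γq :=
    (IsBigO.of_bound (2 * G) (Eventually.of_forall fun k => by
      rw [Real.norm_of_nonneg dist_nonneg, Real.norm_of_nonneg (hγθ.pos k).le]
      exact hinc k)).trans_isLittleO hγ
  have htrack : ∀ i, Tendsto (fun k => q k ω i - M.quantile (z i) (θ k ω)) atTop (𝓝 0) := fun i =>
    tendsto_sub_quantile (q := fun k => q k ω i) hM (hz.mem_Ioo i) hγq.pos hγq.sum_eq_top hγq.tendsto_zero hmem (hn i)
      (hqstep i) hslow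
  have hmean := Model.tendsto_meanDirection_sub_gradJ (w := w) hM hz hmem hqK htrack
  refine ⟨2 * G, hγθ.pos, hγθ.sum_eq_top, hγθ.tendsto_zero, M.isCompact_Θ,
    hM.continuousOn_gradJ w hz, hD, by positivity, hmem, hinc, fun v hv => ?_⟩
  obtain ⟨G', n', hn', hle⟩ := hvar K v hv hqK
  refine ⟨fun k => 2 * ⟪M.meanDirection w z (q k ω) (θ k ω) - M.gradJ w z (θ k ω), θ k ω - v⟫
    + γθ k * G', n', ?_, hn', fun k => ?_⟩
  · have h1 : Tendsto (fun k => ⟪M.meanDirection w z (q k ω) (θ k ω) - M.gradJ w z (θ k ω),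
        θ k ω - v⟫) atTop (𝓝 0) := by
      have h := hmean.norm.mul_const (Metric.diam M.Θ)
      rw [norm_zero, zero_mul] at h
      refine squeeze_zero_norm (fun k => (norm_inner_le_norm _ _).trans ?_) h
      gcongr
      rw [← dist_eq_norm]
      exact Metric.dist_le_diam_of_mem M.isCompact_Θ.isBounded (hmem k) (hDΘ hv)
    simpa using (h1.const_mul 2).add (hγθ.tendsto_zero.mul_const G')
  · refine (hle k).trans_eq ?_
    beta_reduce
    beta_reduce
    rw [inner_sub_left]
    ring

end IsQFRecursion

end DRM

theorem theorem7 {d m N : ℕ} (M : DRM.Model d m)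
    (w : ℝ → ℝ) (hw : DRM.IsC1Distortion w)
    (z : Fin (N + 1) → ℝ) (hz : DRM.IsGrid z)
    (hsmooth : M.SmoothQuantiles)
    (γq γθ : ℕ → ℝ) (hγq : DRM.IsStepSize γq) (hγθ : DRM.IsStepSize γθ)
    (hγ : γθ =o[atTop] γq)
    (hscore : M.BoundedScore)
    {Ω : Type*} [MeasurableSpace Ω] (μ : Measure Ω) [IsProbabilityMeasure μ]
    (X : ℕ → Ω → EuclideanSpace ℝ (Fin m)) (q : ℕ → Ω → Fin (N + 1) → ℝ)
    (θ : ℕ → Ω → EuclideanSpace ℝ (Fin d))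
    (hrec : DRM.IsQFRecursion M w z γq γθ μ X q θ)
    (hdens : DRM.DensityBounds M z μ q θ) :
    ∀ᵐ ω ∂μ, ∃ L : Set (EuclideanSpace ℝ (Fin d)),
      DRM.IsLimitSet M.Θ (M.gradJ w z) L ∧
      DRM.IsInternallyChainTransitive M.Θ (M.gradJ w z) L ∧
      (∀ a, a ∈ L ↔ MapClusterPt a atTop (fun k => θ k ω)) ∧
      Tendsto (fun k => Metric.infDist (θ k ω) L) atTop (𝓝 0) := by
  obtain ⟨D, hD⟩ := hrec.ae_isApproxTrajectory hz hsmooth hγq hγθ hγ hscore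
  filter_upwards [hD] with ω ⟨C, hC⟩
  exact ⟨DRM.clusterSet fun k => θ k ω, hC.isLimitSet_clusterSet,
    hC.isInternallyChainTransitive_clusterSet, fun a => Iff.rfl, hC.tendsto_infDist_clusterSet⟩
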